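/- Let $\mathcal S\subset\mathbb R^3$ be the unit sphere, and let $\mathcal C\subset\mathcal S$ be a simple closed curve of class $C^2$ that divides $\mathcal S$ into two parts: $\mathcal S\setminus\mathcal C=\mathcal S_1\cup\mathcal S_2$ with $\mathcal S_1,\mathcal S_2$ open in $\mathcal S$ and disjoint, and $\mathcal C=\partial\mathcal S_1$. Let $s$ be arc length on $\mathcal C$ and $\vec t$ its unit tangent, oriented positively with respect to $\mathcal S_2$ (as in Stokes' theorem: with $\vec e_r$ the outward radial unit vector, $\vec e_r\times\vec t$ points into $\mathcal S_2$). Let $\Delta_{\mathcal S}$ and $\nabla_{\mathcal S}$ be the Laplace--Beltrami operator and the surface gradient of $\mathcal S$, let $\underline{\mathrm{curl}}_{\mathcal S}f=\nabla_{\mathcal S}f\times\vec e_r$, and let $$U^*(x,y)=-\frac1{4\pi}\log|1-\langle x,y\rangle| .$$ For continuous densities $\sigma,\mu:\mathcal C\to\mathbb R$ define, for $x\notin\mathcal C$, $$(\widetilde V\sigma)(x)=\int_{\mathcal C}U^*(x,y)\,\sigma(y)\,ds_y,\qquad (\widetilde W\mu)(x)=\int_{\mathcal C}\mu(y)\,\bigl[\underline{\mathrm{curl}}_{\mathcal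 S,y}U^*(x,y)\cdot\vec t(y)\bigr]\,ds_y,$$ and, for $x_0\in\mathcal C$, $$(V\sigma)(x_0)=\int_{\mathcal C}U^*(x_0,y)\,\sigma(y)\,ds_y,\qquad (K\mu)(x_0)=\lim_{\varepsilon\to0+}\int_{y\in\mathcal C,\ |y-x_0|\ge\varepsilon}\mu(y)\,\bigl[\underline{\mathrm{curl}}_{\mathcal S,y}U^*(x_0,y)\cdot\vec t(y)\bigr]\,ds_y .$$ Let $g:\mathcal C\to\mathbb R$. We say that $u$ solves the Dirichlet problem with data $g$ if $u$ is $C^\infty$ in $\mathcal S_2$, $-\Delta_{\mathcal S}u=0$ in $\mathcal S_2$, and $\lim_{\mathcal S_2\ni x\to x_0}u(x)=g(x_0)$ for every $x_0\in\mathcal C$. (a) If a continuous $\sigma$ satisfies $V\sigma=g$ on $\mathcal C$ and $\int_{\mathcal C}\sigma\,ds=0$, then $u=\widetilde V\sigma$ solves the Dirichlet problem with data $g$. (b) If a continuous $\mu$ satisfies $(\tfrac12I+K)\mu=g$ on $\mathcal C$, then $u=\widetilde W\mu$ is the solution of the Dirichlet problem with data $g$: it solves it, and every other solution coincides with it in $\mathcal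 S_2$. -/

import Mathlib

open Filter Topology Set
open scoped Manifold ContDiff

/-- Euclidean three-space. -/
abbrev E3 : Type := EuclideanSpace ℝ (Fin 3)

/-- The unit sphere in Euclidean three-space. -/
abbrev Sph : Type := Metric.sphere (0 : E3) 1

instance factFinrankE3 : Fact (Module.finrank ℝ E3 = 2 + 1) := ⟨by simp⟩

/-- The cross product of Euclidean three-space. -/
def cross (a b : E3) : E3 := WithLp.toLp 2 (crossProduct a.ofLp b.ofLp)

theorem norm_inv_smul_mem_sphere {y : E3} (hy : y ≠ 0) :
    ‖y‖⁻¹ • y ∈ Metric.sphere (0 : E3) 1 := by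
  simp [norm_smul, hy]

namespace Sph

noncomputable section

open Classical in
/-- The extension of a function on the sphere that is constant along rays from the origin. -/
def radialExt (u : Sph → ℝ) (y : E3) : ℝ :=
  if hy : y ≠ 0 then u ⟨‖y‖⁻¹ • y, norm_inv_smul_mem_sphere hy⟩ else 0

/-- The Laplace-Beltrami operator of the unit sphere: the Laplacian of Euclidean three-space
applied to the radially constant extension, read on the sphere.  In spherical coordinates it is
`(sin θ)⁻² ∂²/∂φ² + (sin θ)⁻¹ ∂/∂θ (sin θ ∂/∂θ)`. -/
def laplaceBeltrami (u : Sph → ℝ) (x : Sph) : ℝ :=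
  (Laplacian.laplacian (radialExt u) : E3 → ℝ) (x : E3)

/-- The surface gradient: the (automatically tangential) Euclidean gradient of the radially
constant extension; in spherical coordinates
`(sin θ)⁻¹ ∂f/∂φ e_φ + ∂f/∂θ e_θ`. -/
def surfaceGradient (f : Sph → ℝ) (x : Sph) : E3 :=
  gradient (radialExt f) (x : E3)

/-- The vectorial surface rotation `∇ f × e_r`; as `e_θ × e_r = - e_φ` and `e_φ × e_r = e_θ`,
in spherical coordinates it is `- ∂f/∂θ e_φ + (sin θ)⁻¹ ∂f/∂φ e_θ`. -/
def surfaceCurl (f : Sph → ℝ) (x : Sph) : E3 :=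
  cross (surfaceGradient f x) (x : E3)

/-- The fundamental solution `U*(x, y) = -(1/4π) log |1 - (x, y)|`. -/
def fundSol (x y : Sph) : ℝ :=
  -(1 / (4 * Real.pi)) * Real.log |1 - inner ℝ (x : E3) (y : E3)|

end

end Sph

/-- A simple closed curve of class `C²` on the unit sphere, parametrized by arc length and
extended periodically to the real line. -/
structure SphCurve where
  toFun : ℝ → Sph
  length : ℝ
  length_pos : 0 < length
  contDiff : ContDiff ℝ 2 (fun s => (toFun s : E3))
  unit_speed : ∀ s, ‖deriv (fun s => (toFun s : E3)) s‖ = 1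
  periodic : Function.Periodic toFun length
  injOn : InjOn toFun (Ico 0 length)

namespace SphCurve

noncomputable section

/-- The curve as a set of points. -/
def trace (Γ : SphCurve) : Set Sph := range Γ.toFun

/-- The unit tangent vector at the point with parameter `s`. -/
def tangent (Γ : SphCurve) (s : ℝ) : E3 := deriv (fun s => (Γ.toFun s : E3)) s

/-- The line integral `∫_C f ds` with respect to arc length. -/
def lineIntegral (Γ : SphCurve) (f : Sph → ℝ) : ℝ := ∫ s in (0 : ℝ)..Γ.length, f (Γ.toFun s)

/-- The curve divides the sphere into the open sets `S₁` and `S₂`, it is the boundary of `S₁`, and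
it is positively oriented with respect to `S₂`, as in Stokes' theorem: the normal
`e_r × t` of the curve points into `S₂` (that is, short arcs of the great circle that starts on the
curve in the direction `e_r × t` lie in `S₂`, so `S₂` is to the left). -/
structure Divides (Γ : SphCurve) (S₁ S₂ : Set Sph) : Prop where
  isOpen_one : IsOpen S₁
  isOpen_two : IsOpen S₂
  disjoint : Disjoint S₁ S₂
  union_eq : S₁ ∪ S₂ = Γ.traceᶜ
  frontier_eq : frontier S₁ = Γ.trace
  oriented : ∀ s, ∀ᶠ δ in 𝓝[>] (0 : ℝ),
    Real.cos δ • (Γ.toFun s : E3) + Real.sin δ • cross (Γ.toFun s : E3) (Γ.tangent s) ∈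
      ((↑) '' S₂ : Set E3)

/-- The single layer potential, for `x` off the curve. -/
def singleLayer (Γ : SphCurve) (σ : Sph → ℝ) (x : Sph) : ℝ :=
  Γ.lineIntegral fun y => Sph.fundSol x y * σ y

/-- The boundary operator `V`: the weakly singular integral, for `x₀` on the curve. -/
def opV (Γ : SphCurve) (σ : Sph → ℝ) (x₀ : Sph) : ℝ :=
  Γ.lineIntegral fun y => Sph.fundSol x₀ y * σ y

/-- The kernel `curl U*(x, y) · t(y)` at the point `y` of the curve with parameter `s`; the surface
rotation is taken with respect to `y`. -/
def doubleKernel (Γ : SphCurve) (x : Sph) (s : ℝ) : ℝ :=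
  inner ℝ (Sph.surfaceCurl (fun y => Sph.fundSol x y) (Γ.toFun s)) (Γ.tangent s)

/-- The double layer potential, for `x` off the curve. -/
def doubleLayer (Γ : SphCurve) (μ : Sph → ℝ) (x : Sph) : ℝ :=
  ∫ s in (0 : ℝ)..Γ.length, μ (Γ.toFun s) * Γ.doubleKernel x s

open Classical in
/-- The truncated integral over the part of the curve at distance at least `ε` from `x₀`. -/
def opKTrunc (Γ : SphCurve) (μ : Sph → ℝ) (x₀ : Sph) (ε : ℝ) : ℝ :=
  ∫ s in (0 : ℝ)..Γ.length,
    if ε ≤ dist (Γ.toFun s) x₀ then μ (Γ.toFun s) * Γ.doubleKernel x₀ s else 0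

/-- The boundary operator `K`: the principal value of the double layer integral, for `x₀` on
the curve.  (For a `C²` curve and a continuous density the limit exists.) -/
def opK (Γ : SphCurve) (μ : Sph → ℝ) (x₀ : Sph) : ℝ :=
  limUnder (𝓝[>] (0 : ℝ)) (Γ.opKTrunc μ x₀)

/-- `u` solves the Dirichlet problem: it is smooth in `S₂`, its Laplace-Beltrami derivative
vanishes there, and it takes the boundary values `g` on the curve as limits from `S₂`. -/
structure SolvesDirichlet (Γ : SphCurve) (S₂ : Set Sph) (g u : Sph → ℝ) : Prop where
  smooth : ContMDiffOn (𝓡 2) 𝓘(ℝ, ℝ) ∞ u S₂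
  harmonic : ∀ x ∈ S₂, Sph.laplaceBeltrami u x = 0
  boundary : ∀ x₀ ∈ Γ.trace, Tendsto u (𝓝[S₂] x₀) (𝓝 (g x₀))

end

end SphCurve

/-! Write n = e_r × t. The Laplacian of x ↦ -(1/4π) log(1 - ⟨x,y⟩) is the constant 1/(4π) away from
y, so Δ(Ṽσ) = (1/4π)∫σ, which vanishes for a density of mean zero. The kernel of W̃ is the normal
derivative (1/4π) ⟨x,n⟩/(1 - ⟨x,y⟩), which is harmonic in x away from y (`doubleKernel_eq`,
`laplacian_dipoleKernel`). Differentiation under the integral then gives smoothness and harmonicity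
off the curve.

The boundary values rest on the nearest point ("foot") of the curve to x, with parameter r. By
stationarity x = β p(r) + η n(r), without tangential component. The C² regularity gives |⟨p(r),
n(r+h)⟩| ≤ M h², and the chord-arc inequality gives 1 - ⟨x, p(r+h)⟩ ≥ c h². The single layer
therefore has a logarithmic majorant and is continuous on the curve, with values Vσ. In the double
layer the β-part has a bounded kernel and tends to Kμ, which is an ordinary integral (`opK_eq`). The
η-part is rescaled by h = ητ and becomes a Poisson integral: (1/4π) ∫ 2/(1+τ²) dτ = 1/2
(`tendsto_singular_part`). Here η > 0 on S₂ near the curve, by the orientation and the connectedness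
of one-sided tubes (`Divides.eventually_inner_normal_foot_pos`).

Uniqueness is the weak maximum principle for differences of solutions. A small multiple of the
logarithmic kernel with pole in S₁ has positive Laplacian on S₂ and excludes interior maxima. -/

/-! ### Second derivatives along lines -/

theorem tendsto_line {E : Type*} [NormedAddCommGroup E] [NormedSpace ℝ E] (x v : E) :
    Tendsto (fun r : ℝ => x + r • v) (𝓝 0) (𝓝 x) := by
  have : Continuous fun r : ℝ => x + r • v := by fun_prop
  simpa using this.tendsto 0

theorem hasDerivAt_line {E : Type*} [NormedAddCommGroup E] [NormedSpace ℝ E] (x v : E) (r : ℝ) :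
    HasDerivAt (fun r : ℝ => x + r • v) v r := by
  simpa using ((hasDerivAt_id r).smul_const v).const_add x

theorem ContDiffAt.eventually_hasDerivAt_line {E : Type*} [NormedAddCommGroup E] [NormedSpace ℝ E]
    {G : E → ℝ} {x : E} (hG : ContDiffAt ℝ 2 G x) (v : E) :
    ∀ᶠ r in 𝓝 (0 : ℝ),
      HasDerivAt (fun r : ℝ => G (x + r • v)) (fderiv ℝ G (x + r • v) v) r := by
  filter_upwards [(tendsto_line x v).eventually (hG.eventually (by simp))] with r hr
  exact (hr.differentiableAt (by norm_num)).hasFDerivAt.comp_hasDerivAt r (hasDerivAt_line x v r)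

theorem ContDiffAt.hasDerivAt_fderiv_line {E : Type*} [NormedAddCommGroup E] [NormedSpace ℝ E]
    {G : E → ℝ} {x : E} (hG : ContDiffAt ℝ 2 G x) (v : E) :
    HasDerivAt (fun r : ℝ => fderiv ℝ G (x + r • v) v) (iteratedFDeriv ℝ 2 G x ![v, v]) 0 := by
  have hd2 : DifferentiableAt ℝ (fderiv ℝ G) x :=
    (hG.fderiv_right (m := 1) (by norm_num)).differentiableAt (by norm_num)
  have h3 : HasFDerivAt (fderiv ℝ G) (fderiv ℝ (fderiv ℝ G) x) (x + (0 : ℝ) • v) := by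
    simpa using hd2.hasFDerivAt
  have h4 := h3.comp_hasDerivAt (0 : ℝ) (hasDerivAt_line x v 0)
  rw [iteratedFDeriv_two_apply]
  simpa using h4.clm_apply (hasDerivAt_const (0 : ℝ) v)

/-- The second derivative of a `C²` function in a direction, from the derivatives along a line. -/
theorem iteratedFDeriv_two_diag_eq {E : Type*} [NormedAddCommGroup E] [NormedSpace ℝ E]
    {G : E → ℝ} {x v : E} (hG : ContDiffAt ℝ 2 G x) {φ : ℝ → ℝ} {c : ℝ}
    (h1 : ∀ᶠ r in 𝓝 (0 : ℝ), HasDerivAt (fun r : ℝ => G (x + r • v)) (φ r) r)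
    (h2 : HasDerivAt φ c 0) : iteratedFDeriv ℝ 2 G x ![v, v] = c := by
  have hφ : φ =ᶠ[𝓝 0] fun r => fderiv ℝ G (x + r • v) v := by
    filter_upwards [h1, hG.eventually_hasDerivAt_line v] with r hr hd
    exact hr.unique hd
  exact ((hG.hasDerivAt_fderiv_line v).congr_of_eventuallyEq hφ).unique h2

/-! ### Differentiation under the integral sign -/

/-- A function continuous around a compact slice is locally bounded uniformly on the slice. -/
theorem eventually_slice_bounded {E P F : Type*} [TopologicalSpace E] [TopologicalSpace P]
    [NormedAddCommGroup F] {Ω : Set (E × P)} (hΩ : IsOpen Ω) {Φ : E × P → F}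
    (hΦ : ContinuousOn Φ Ω) {K : Set P} (hK : IsCompact K) {x : E}
    (hx : ∀ p ∈ K, (x, p) ∈ Ω) :
    ∃ C : ℝ, ∀ᶠ y in 𝓝 x, ∀ p ∈ K, (y, p) ∈ Ω ∧ ‖Φ (y, p)‖ ≤ C := by
  have hc : IsCompact (({x} : Set E) ×ˢ K) := isCompact_singleton.prod hK
  have hs : ({x} : Set E) ×ˢ K ⊆ Ω := by
    rintro ⟨y, p⟩ ⟨hy, hp⟩
    obtain rfl : y = x := hy
    exact hx p hp
  obtain ⟨C, hC⟩ := hc.exists_bound_of_continuousOn (hΦ.mono hs)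
  have ho : IsOpen (Ω ∩ (fun q => ‖Φ q‖) ⁻¹' Iio (C + 1)) :=
    hΦ.norm.isOpen_inter_preimage hΩ isOpen_Iio
  obtain ⟨u, v, hu, hv, hxu, hKv, huv⟩ := generalized_tube_lemma isCompact_singleton hK ho
    (fun q hq => ⟨hs hq, lt_of_le_of_lt (hC q hq) (lt_add_one C)⟩)
  refine ⟨C + 1, ?_⟩
  filter_upwards [hu.mem_nhds (hxu rfl)] with y hy p hp
  have := huv (mk_mem_prod hy (hKv hp))
  exact ⟨this.1, this.2.le⟩

theorem isOpen_slice {E P : Type*} [TopologicalSpace E] [TopologicalSpace P] {a : ℝ → P}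
    {Ω : Set (E × P)} {L : ℝ} (hΩ : IsOpen Ω) (ha : Continuous a) :
    IsOpen {x : E | ∀ s ∈ uIcc 0 L, (x, a s) ∈ Ω} := by
  rw [isOpen_iff_mem_nhds]
  intro x hx
  -- The zero function is a dummy: only the membership half of the conclusion is wanted.
  obtain ⟨C, hC⟩ := eventually_slice_bounded (F := ℝ) (Φ := fun _ => 0) hΩ continuousOn_const
    ((isCompact_uIcc (a := (0 : ℝ)) (b := L)).image ha) (x := x)
    (by rintro _ ⟨s, hs, rfl⟩; exact hx s hs)
  filter_upwards [hC] with y hy s hs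
  exact (hy _ (mem_image_of_mem a hs)).1

theorem continuousOn_slice {E P F : Type*} [TopologicalSpace E] [TopologicalSpace P]
    [TopologicalSpace F] {a : ℝ → P} {Ω : Set (E × P)} {L : ℝ} {Φ : E × P → F}
    (hΦ : ContinuousOn Φ Ω) (ha : Continuous a) {x : E} (hx : ∀ s ∈ uIcc 0 L, (x, a s) ∈ Ω) :
    ContinuousOn (fun s => Φ (x, a s)) (uIcc 0 L) :=
  hΦ.comp (by fun_prop) hx

theorem continuousOn_parametric {E P F : Type*} [TopologicalSpace E] [FirstCountableTopology E]
    [TopologicalSpace P] [NormedAddCommGroup F] [NormedSpace ℝ F] {a : ℝ → P} {Ω : Set (E × P)}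
    {L : ℝ} {Φ : E × P → F} (hΩ : IsOpen Ω) (ha : Continuous a) (hΦ : ContinuousOn Φ Ω) :
    ContinuousOn (fun y => ∫ s in (0 : ℝ)..L, Φ (y, a s))
      {x : E | ∀ s ∈ uIcc 0 L, (x, a s) ∈ Ω} := by
  intro x hx
  refine ContinuousAt.continuousWithinAt ?_
  obtain ⟨C, hC⟩ := eventually_slice_bounded hΩ hΦ
    ((isCompact_uIcc (a := (0 : ℝ)) (b := L)).image ha) (x := x)
    (by rintro _ ⟨s, hs, rfl⟩; exact hx s hs)
  have hC' : ∀ᶠ y in 𝓝 x, ∀ s ∈ uIcc 0 L, (y, a s) ∈ Ω ∧ ‖Φ (y, a s)‖ ≤ C :=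
    hC.mono fun y hy s hs => hy _ (mem_image_of_mem a hs)
  refine intervalIntegral.continuousAt_of_dominated_interval (bound := fun _ => C) ?_ ?_ ?_ ?_
  · filter_upwards [hC'] with y hy
    exact (intervalIntegrable_iff.1 (continuousOn_slice hΦ ha fun s hs =>
      (hy s hs).1).intervalIntegrable).aestronglyMeasurable
  · filter_upwards [hC'] with y hy
    exact Eventually.of_forall fun s hs => (hy s (uIoc_subset_uIcc hs)).2
  · exact intervalIntegrable_const
  · refine Eventually.of_forall fun s hs => ?_
    have := hΦ.continuousAt (hΩ.mem_nhds (hx s (uIoc_subset_uIcc hs)))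
    exact ContinuousAt.comp (f := fun y => (y, a s)) this (by fun_prop)

section Parametric

variable {E P : Type} [NormedAddCommGroup E] [NormedSpace ℝ E] [NormedAddCommGroup P]
  [NormedSpace ℝ P]

/-- The partial derivative in the first variable. -/
noncomputable def fderivFst {F : Type} [NormedAddCommGroup F] [NormedSpace ℝ F] (Φ : E × P → F)
    (q : E × P) : E →L[ℝ] F :=
  (fderiv ℝ Φ q).comp (ContinuousLinearMap.inl ℝ E P)

theorem fderivFst_contDiffOn {F : Type} [NormedAddCommGroup F] [NormedSpace ℝ F] {Φ : E × P → F}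
    {Ω : Set (E × P)} (hΩ : IsOpen Ω) {m n : ℕ∞} (hmn : m + 1 ≤ n) (hΦ : ContDiffOn ℝ n Φ Ω) :
    ContDiffOn ℝ m (fderivFst Φ) Ω :=
  (hΦ.fderiv_of_isOpen hΩ (by exact_mod_cast hmn)).clm_comp contDiffOn_const

theorem hasFDerivAt_fderivFst {F : Type} [NormedAddCommGroup F] [NormedSpace ℝ F] {Φ : E × P → F}
    {x : E} {p : P} (h : DifferentiableAt ℝ Φ (x, p)) :
    HasFDerivAt (fun y => Φ (y, p)) (fderivFst Φ (x, p)) x :=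
  HasFDerivAt.comp x (f := fun y => (y, p)) h.hasFDerivAt (hasFDerivAt_prodMk_left x p)

variable {a : ℝ → P} {Ω : Set (E × P)} {L : ℝ}

/-- Position, normal and density enter through the path `a`, which is merely continuous. The
smoothness is all in `Φ`, whose partial derivative is bounded near the compact slice; this constant
is the majorant. -/
theorem hasFDerivAt_parametric {F : Type} [NormedAddCommGroup F] [NormedSpace ℝ F]
    {Φ : E × P → F} (hΩ : IsOpen Ω) (ha : Continuous a)
    (hΦ : ContDiffOn ℝ 1 Φ Ω) {x : E} (hx : ∀ s ∈ uIcc 0 L, (x, a s) ∈ Ω) :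
    HasFDerivAt (fun y => ∫ s in (0 : ℝ)..L, Φ (y, a s))
      (∫ s in (0 : ℝ)..L, fderivFst Φ (x, a s)) x := by
  have hD : ContinuousOn (fderivFst Φ) Ω :=
    (fderivFst_contDiffOn (m := 0) (n := 1) hΩ (by simp) hΦ).continuousOn
  obtain ⟨C, hC⟩ := eventually_slice_bounded hΩ hD
    ((isCompact_uIcc (a := (0 : ℝ)) (b := L)).image ha) (x := x)
    (by rintro _ ⟨s, hs, rfl⟩; exact hx s hs)
  have hC' : ∀ᶠ y in 𝓝 x, ∀ s ∈ uIcc 0 L, (y, a s) ∈ Ω ∧ ‖fderivFst Φ (y, a s)‖ ≤ C :=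
    hC.mono fun y hy s hs => hy _ (mem_image_of_mem a hs)
  refine (intervalIntegral.hasFDerivAt_integral_of_dominated_of_fderiv_le
    (F := fun y s => Φ (y, a s)) (F' := fun y s => fderivFst Φ (y, a s))
    (bound := fun _ => C) hC' ?_ ?_ ?_ ?_ ?_ ?_)
  · filter_upwards [hC'] with y hy
    exact (intervalIntegrable_iff.1 (continuousOn_slice hΦ.continuousOn ha fun s hs =>
      (hy s hs).1).intervalIntegrable).aestronglyMeasurable
  · exact (continuousOn_slice hΦ.continuousOn ha hx).intervalIntegrable
  · exact (intervalIntegrable_iff.1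
      (continuousOn_slice hD ha hx).intervalIntegrable).aestronglyMeasurable
  · exact Eventually.of_forall fun s hs y hy => (hy s (uIoc_subset_uIcc hs)).2
  · exact intervalIntegrable_const
  · refine Eventually.of_forall fun s hs y hy => hasFDerivAt_fderivFst ?_
    have hm := (hy s (uIoc_subset_uIcc hs)).1
    exact (hΦ.contDiffAt (hΩ.mem_nhds hm)).differentiableAt (by norm_num)

/-- The target space is quantified inside the induction because each differentiation replaces `F` by
`E →L[ℝ] F`. -/
theorem contDiffOn_parametric_nat (hΩ : IsOpen Ω) (ha : Continuous a) (n : ℕ) :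
    ∀ {F : Type} [NormedAddCommGroup F] [NormedSpace ℝ F] {Φ : E × P → F},
    ContDiffOn ℝ n Φ Ω → ContDiffOn ℝ n (fun y => ∫ s in (0 : ℝ)..L, Φ (y, a s))
      {x : E | ∀ s ∈ uIcc 0 L, (x, a s) ∈ Ω} := by
  induction n with
  | zero =>
    intro F _ _ Φ hΦ
    exact contDiffOn_zero.2 (continuousOn_parametric hΩ ha hΦ.continuousOn)
  | succ n ih =>
    intro F _ _ Φ hΦ
    have h1 : ContDiffOn ℝ 1 Φ Ω := hΦ.of_le (by exact_mod_cast Nat.le_add_left 1 n)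
    have hd : ∀ x ∈ {x : E | ∀ s ∈ uIcc 0 L, (x, a s) ∈ Ω}, _ := fun x hx =>
      hasFDerivAt_parametric hΩ ha h1 hx
    rw [Nat.cast_succ, contDiffOn_succ_iff_fderiv_of_isOpen (isOpen_slice hΩ ha)]
    refine ⟨fun x hx => (hd x hx).differentiableAt.differentiableWithinAt, by simp, ?_⟩
    refine (ih (fderivFst_contDiffOn (m := n) (n := (n + 1 : ℕ)) hΩ (by simp) hΦ)).congr ?_
    intro x hx
    exact (hd x hx).fderiv

theorem contDiffOn_parametric {F : Type} [NormedAddCommGroup F] [NormedSpace ℝ F]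
    {Φ : E × P → F} (hΩ : IsOpen Ω) (ha : Continuous a) (hΦ : ContDiffOn ℝ ∞ Φ Ω) :
    ContDiffOn ℝ ∞ (fun y => ∫ s in (0 : ℝ)..L, Φ (y, a s))
      {x : E | ∀ s ∈ uIcc 0 L, (x, a s) ∈ Ω} :=
  contDiffOn_infty.2 fun n => contDiffOn_parametric_nat hΩ ha n (contDiffOn_infty.1 hΦ n)

/-- The second derivative of a parametric integral is the integral of the second derivatives. -/
theorem iteratedFDeriv_two_parametric [CompleteSpace E] {Φ : E × P → ℝ} (hΩ : IsOpen Ω)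
    (ha : Continuous a)
    (hΦ : ContDiffOn ℝ ∞ Φ Ω) {x : E} (hx : ∀ s ∈ uIcc 0 L, (x, a s) ∈ Ω) (v w : E) :
    IntervalIntegrable (fun s => iteratedFDeriv ℝ 2 (fun y => Φ (y, a s)) x ![v, w])
      MeasureTheory.volume 0 L ∧
    iteratedFDeriv ℝ 2 (fun y => ∫ s in (0 : ℝ)..L, Φ (y, a s)) x ![v, w] =
      ∫ s in (0 : ℝ)..L, iteratedFDeriv ℝ 2 (fun y => Φ (y, a s)) x ![v, w] := by
  have h1 : ContDiffOn ℝ ∞ (fderivFst Φ) Ω :=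
    fderivFst_contDiffOn (m := ⊤) (n := ⊤) hΩ (by simp) hΦ
  have h2 : ContDiffOn ℝ ∞ (fderivFst (fderivFst Φ)) Ω :=
    fderivFst_contDiffOn (m := ⊤) (n := ⊤) hΩ (by simp) h1
  have hU := (isOpen_slice (L := L) hΩ ha).mem_nhds hx
  have e1 : fderiv ℝ (fun y => ∫ s in (0 : ℝ)..L, Φ (y, a s)) =ᶠ[𝓝 x]
      fun y => ∫ s in (0 : ℝ)..L, fderivFst Φ (y, a s) := by
    filter_upwards [hU] with y hy
    exact (hasFDerivAt_parametric hΩ ha (hΦ.of_le (by simp)) hy).fderiv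
  have e2 : ∀ s ∈ uIcc 0 L, fderivFst (fderivFst Φ) (x, a s) v w =
      iteratedFDeriv ℝ 2 (fun y => Φ (y, a s)) x ![v, w] := by
    intro s hs
    rw [iteratedFDeriv_two_apply]
    have hn : {y | (y, a s) ∈ Ω} ∈ 𝓝 x :=
      (hΩ.preimage (by fun_prop : Continuous fun y : E => (y, a s))).mem_nhds (hx s hs)
    have e3 : fderiv ℝ (fun y => Φ (y, a s)) =ᶠ[𝓝 x] fun y => fderivFst Φ (y, a s) := by
      filter_upwards [hn] with y hy
      exact (hasFDerivAt_fderivFst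
        ((hΦ.contDiffAt (hΩ.mem_nhds hy)).differentiableAt (by simp))).fderiv
    rw [e3.fderiv_eq, (hasFDerivAt_fderivFst
        ((h1.contDiffAt (hΩ.mem_nhds (hx s hs))).differentiableAt (by simp))).fderiv]
    simp
  have hi : IntervalIntegrable (fun s => fderivFst (fderivFst Φ) (x, a s))
      MeasureTheory.volume 0 L :=
    (continuousOn_slice h2.continuousOn ha hx).intervalIntegrable
  constructor
  · have hc : ContinuousOn (fun s => fderivFst (fderivFst Φ) (x, a s) v w) (uIcc 0 L) :=
      ((continuousOn_slice h2.continuousOn ha hx).clm_apply continuousOn_const).clm_apply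
        continuousOn_const
    exact (hc.congr fun s hs => (e2 s hs).symm).intervalIntegrable
  · rw [iteratedFDeriv_two_apply, e1.fderiv_eq,
      (hasFDerivAt_parametric hΩ ha (h1.of_le (by simp)) hx).fderiv]
    simp only [Matrix.cons_val_zero, Matrix.cons_val_one]
    rw [ContinuousLinearMap.intervalIntegral_apply hi, ContinuousLinearMap.intervalIntegral_apply]
    · exact intervalIntegral.integral_congr e2
    · exact ((continuousOn_slice h2.continuousOn ha hx).clm_apply
        continuousOn_const).intervalIntegrable

end Parametric

/-- The Laplacian of a parametric integral is the integral of the Laplacians. -/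
theorem laplacian_parametric {E P : Type} [NormedAddCommGroup E] [InnerProductSpace ℝ E]
    [FiniteDimensional ℝ E] [NormedAddCommGroup P] [NormedSpace ℝ P] {a : ℝ → P}
    {Ω : Set (E × P)} {L : ℝ} {Φ : E × P → ℝ} (hΩ : IsOpen Ω) (ha : Continuous a)
    (hΦ : ContDiffOn ℝ ∞ Φ Ω) {x : E} (hx : ∀ s ∈ uIcc 0 L, (x, a s) ∈ Ω) :
    (Laplacian.laplacian (fun y => ∫ s in (0 : ℝ)..L, Φ (y, a s)) : E → ℝ) x =
      ∫ s in (0 : ℝ)..L, (Laplacian.laplacian (fun y => Φ (y, a s)) : E → ℝ) x := by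
  simp only [InnerProductSpace.laplacian_eq_iteratedFDeriv_stdOrthonormalBasis]
  rw [intervalIntegral.integral_finsetSum]
  · exact Finset.sum_congr rfl fun i _ => (iteratedFDeriv_two_parametric hΩ ha hΦ hx _ _).2
  · exact fun i _ => (iteratedFDeriv_two_parametric hΩ ha hΦ hx _ _).1

/-! ### The ray-invariant kernels and their domain of smoothness -/

/-- The logarithmic kernel with weight `p.2`, extended constantly along rays. -/
noncomputable def logKernel (q : E3 × (E3 × ℝ)) : ℝ :=
  (-(1 / (4 * Real.pi)) * Real.log (1 - inner ℝ (‖q.1‖⁻¹ • q.1) q.2.1)) * q.2.2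

/-- The normal derivative of the logarithmic kernel with weight, extended constantly along rays. -/
noncomputable def dipoleKernel (q : E3 × (E3 × E3 × ℝ)) : ℝ :=
  q.2.2.2 * (1 / (4 * Real.pi) * (inner ℝ (‖q.1‖⁻¹ • q.1) q.2.2.1 /
    (1 - inner ℝ (‖q.1‖⁻¹ • q.1) q.2.1)))

theorem contDiffAt_norm_inv_smul {E : Type*} [NormedAddCommGroup E] [InnerProductSpace ℝ E]
    {x : E} (hx : x ≠ 0) : ContDiffAt ℝ ∞ (fun x : E => ‖x‖⁻¹ • x) x :=
  ((contDiffAt_norm ℝ hx).inv (norm_ne_zero_iff.2 hx)).smul contDiffAt_id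

/-- The points where a kernel with pole `f p` is smooth. -/
def kernelDomain {P : Type*} (f : P → E3) : Set (E3 × P) :=
  {q | q.1 ≠ 0 ∧ inner ℝ (‖q.1‖⁻¹ • q.1) (f q.2) ≠ (1 : ℝ)}

theorem isOpen_kernelDomain {P : Type*} [TopologicalSpace P] {f : P → E3} (hf : Continuous f) :
    IsOpen (kernelDomain f) := by
  rw [isOpen_iff_mem_nhds]
  rintro ⟨x, p⟩ ⟨hx, hp⟩
  have h1 : ContinuousAt (fun q : E3 × P => ‖q.1‖⁻¹ • q.1) (x, p) :=
    ContinuousAt.comp (g := fun x : E3 => ‖x‖⁻¹ • x) (contDiffAt_norm_inv_smul hx).continuousAt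
      continuousAt_fst
  have h2 : ContinuousAt (fun q : E3 × P => f q.2) (x, p) := by fun_prop
  have h3 : ContinuousAt (fun q : E3 × P => (inner ℝ (‖q.1‖⁻¹ • q.1) (f q.2) : ℝ)) (x, p) :=
    h1.inner h2
  filter_upwards [continuousAt_fst.eventually_ne hx, h3.eventually_ne hp] with q ha hb
  exact ⟨ha, hb⟩

theorem contDiffOn_logKernel : ContDiffOn ℝ ∞ logKernel (kernelDomain fun p => p.1) := by
  rintro ⟨x, p⟩ ⟨hx, hp⟩
  refine ContDiffAt.contDiffWithinAt ?_
  have h1 : ContDiffAt ℝ ∞ (fun q : E3 × (E3 × ℝ) => ‖q.1‖⁻¹ • q.1) (x, p) :=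
    ContDiffAt.comp (g := fun x : E3 => ‖x‖⁻¹ • x) (x, p) (contDiffAt_norm_inv_smul hx)
      contDiffAt_fst
  have h2 : ContDiffAt ℝ ∞ (fun q : E3 × (E3 × ℝ) => q.2.1) (x, p) := by fun_prop
  have h3 : ContDiffAt ℝ ∞ (fun q : E3 × (E3 × ℝ) => q.2.2) (x, p) := by fun_prop
  exact (contDiffAt_const.mul ((contDiffAt_const.sub (h1.inner ℝ h2)).log
    (sub_ne_zero.2 hp.symm))).mul h3

theorem contDiffOn_dipoleKernel : ContDiffOn ℝ ∞ dipoleKernel (kernelDomain fun p => p.1) := by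
  rintro ⟨x, p⟩ ⟨hx, hp⟩
  refine ContDiffAt.contDiffWithinAt ?_
  have h1 : ContDiffAt ℝ ∞ (fun q : E3 × (E3 × E3 × ℝ) => ‖q.1‖⁻¹ • q.1) (x, p) :=
    ContDiffAt.comp (g := fun x : E3 => ‖x‖⁻¹ • x) (x, p) (contDiffAt_norm_inv_smul hx)
      contDiffAt_fst
  have h2 : ContDiffAt ℝ ∞ (fun q : E3 × (E3 × E3 × ℝ) => q.2.1) (x, p) := by fun_prop
  have h3 : ContDiffAt ℝ ∞ (fun q : E3 × (E3 × E3 × ℝ) => q.2.2.1) (x, p) := by fun_prop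
  have h4 : ContDiffAt ℝ ∞ (fun q : E3 × (E3 × E3 × ℝ) => q.2.2.2) (x, p) := by fun_prop
  exact h4.mul (contDiffAt_const.mul ((h1.inner ℝ h3).div (contDiffAt_const.sub (h1.inner ℝ h2))
    (sub_ne_zero.2 hp.symm)))

theorem two_le_infty : (2 : WithTop ℕ∞) ≤ ∞ := WithTop.coe_le_coe.2 le_top

/-! ### Second derivatives of the kernels along great circles -/

section GreatCircle

variable {x v : E3}

theorem norm_add_smul_of_orthonormal (hx : ‖x‖ = 1) (hv : ‖v‖ = 1) (hxv : inner ℝ x v = (0 : ℝ))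
    (r : ℝ) : ‖x + r • v‖ = √(1 + r ^ 2) := by
  rw [eq_comm, Real.sqrt_eq_iff_eq_sq (by positivity) (norm_nonneg _), norm_add_sq_real,
    norm_smul, inner_smul_right, hxv, hx, hv, Real.norm_eq_abs, mul_one, sq_abs]
  ring

/-- The coordinate in the direction `y` of the central projection of the tangent line. -/
theorem inner_proj_tangentLine (hx : ‖x‖ = 1) (hv : ‖v‖ = 1) (hxv : inner ℝ x v = (0 : ℝ))
    (y : E3) (r : ℝ) : (inner ℝ (‖x + r • v‖⁻¹ • (x + r • v)) y : ℝ) =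
      (√(1 + r ^ 2))⁻¹ * (inner ℝ x y + r * inner ℝ v y) := by
  rw [norm_add_smul_of_orthonormal hx hv hxv, real_inner_smul_left, inner_add_left,
    real_inner_smul_left]

theorem hasDerivAt_inv_sqrt_one_add_sq (r : ℝ) :
    HasDerivAt (fun r : ℝ => (√(1 + r ^ 2))⁻¹) (-r * (√(1 + r ^ 2))⁻¹ ^ 3) r := by
  have h0 : (0 : ℝ) < 1 + r ^ 2 := by positivity
  have h1 : HasDerivAt (fun r : ℝ => 1 + r ^ 2) (2 * r) r := by
    simpa using (hasDerivAt_pow 2 r).const_add 1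
  have h2 := (h1.sqrt h0.ne').inv (Real.sqrt_pos.2 h0).ne'
  refine HasDerivAt.congr_deriv (f := fun r : ℝ => (√(1 + r ^ 2))⁻¹) h2 ?_
  have := (Real.sqrt_pos.2 h0).ne'
  field_simp

/-- The derivative of `inner_proj_tangentLine`. -/
noncomputable def projDeriv (a b r : ℝ) : ℝ :=
  (-r * (√(1 + r ^ 2))⁻¹ ^ 3) * (a + r * b) + (√(1 + r ^ 2))⁻¹ * b

theorem hasDerivAt_proj (a b r : ℝ) :
    HasDerivAt (fun r : ℝ => (√(1 + r ^ 2))⁻¹ * (a + r * b)) (projDeriv a b r) r := by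
  have := (hasDerivAt_inv_sqrt_one_add_sq r).mul (((hasDerivAt_id r).mul_const b).const_add a)
  exact this.congr_deriv (by simp [projDeriv])

theorem projDeriv_zero (a b : ℝ) : projDeriv a b 0 = b := by simp [projDeriv]

/-- With r = tan θ the coordinate is a cos θ + b sin θ, and r agrees with θ to second order at 0. -/
theorem hasDerivAt_projDeriv_zero (a b : ℝ) : HasDerivAt (projDeriv a b) (-a) 0 := by
  have h1 := hasDerivAt_inv_sqrt_one_add_sq 0
  have h2 := (((hasDerivAt_id (0 : ℝ)).neg.mul (h1.pow 3)).mul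
    (((hasDerivAt_id (0 : ℝ)).mul_const b).const_add a)).add (h1.mul_const b)
  have h3 : HasDerivAt (projDeriv a b) _ 0 := h2
  simpa using h3

/-- The second derivative of a function of the logarithmic kernel along a great circle. -/
theorem iteratedFDeriv_logKernel_tangent (hx : ‖x‖ = 1) (hv : ‖v‖ = 1)
    (hxv : inner ℝ x v = (0 : ℝ)) {y : E3} (w : ℝ) (hy : inner ℝ x y ≠ (1 : ℝ)) :
    iteratedFDeriv ℝ 2 (fun X => logKernel (X, y, w)) x ![v, v] =
      (1 / (4 * Real.pi)) * w * ((inner ℝ v y) ^ 2 / (1 - inner ℝ x y) ^ 2 -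
        inner ℝ x y / (1 - inner ℝ x y)) := by
  have hx0 : x ≠ 0 := norm_ne_zero_iff.1 (by simp [hx])
  have hmem : (x, y, w) ∈ kernelDomain (fun p : E3 × ℝ => p.1) := ⟨hx0, by simpa [hx] using hy⟩
  have hG : ContDiffAt ℝ 2 (fun X => logKernel (X, y, w)) x :=
    ((contDiffOn_logKernel.contDiffAt ((isOpen_kernelDomain continuous_fst).mem_nhds hmem)).comp
      (f := fun X => (X, y, w)) x (by fun_prop)).of_le two_le_infty
  set a : ℝ := inner ℝ x y with ha
  set b : ℝ := inner ℝ v y with hb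
  set Z : ℝ → ℝ := fun r => (√(1 + r ^ 2))⁻¹ * (a + r * b) with hZ
  have hZ0 : Z 0 = a := by simp [hZ]
  have hne : ∀ᶠ r in 𝓝 (0 : ℝ), 1 - Z r ≠ 0 :=
    ((hasDerivAt_proj a b 0).continuousAt.const_sub 1).eventually_ne
      (by simpa using sub_ne_zero.2 hy.symm)
  have hfun : (fun r : ℝ => logKernel (x + r • v, y, w)) =
      fun r => (-(1 / (4 * Real.pi)) * Real.log (1 - Z r)) * w := by
    ext r
    simp only [logKernel, inner_proj_tangentLine hx hv hxv, hZ, ha, hb]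
  refine iteratedFDeriv_two_diag_eq hG
    (φ := fun r => (-(1 / (4 * Real.pi)) * (-projDeriv a b r / (1 - Z r))) * w) ?_ ?_
  · rw [hfun]
    filter_upwards [hne] with r hr
    exact ((((hasDerivAt_proj a b r).const_sub 1).log hr).const_mul _).mul_const w
  · have hD : 1 - Z 0 ≠ 0 := hne.self_of_nhds
    have := ((((hasDerivAt_projDeriv_zero a b).neg.div ((hasDerivAt_proj a b 0).const_sub 1)
      hD).const_mul (-(1 / (4 * Real.pi)))).mul_const w)
    refine HasDerivAt.congr_deriv
      (f := fun r => (-(1 / (4 * Real.pi)) * (-projDeriv a b r / (1 - Z r))) * w) this ?_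
    simp only [projDeriv_zero, Pi.neg_apply]
    change -(1 / (4 * Real.pi)) * ((- -a * (1 - Z 0) - -b * -b) / (1 - Z 0) ^ 2) * w = _
    rw [hZ0] at hD ⊢
    field_simp
    ring

/-- Quotient rule for N/(1 - Z), the coordinates of the great circle along n and y. The
contributions of N'' = -m and Z'' = -a combine to -m/(1-a)². -/
theorem iteratedFDeriv_dipoleKernel_tangent (hx : ‖x‖ = 1) (hv : ‖v‖ = 1)
    (hxv : inner ℝ x v = (0 : ℝ)) {y n : E3} (w : ℝ) (hy : inner ℝ x y ≠ (1 : ℝ)) :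
    iteratedFDeriv ℝ 2 (fun X => dipoleKernel (X, y, n, w)) x ![v, v] =
      w * (1 / (4 * Real.pi)) * (-inner ℝ x n / (1 - inner ℝ x y) ^ 2 +
        2 * inner ℝ v n * inner ℝ v y / (1 - inner ℝ x y) ^ 2 +
        2 * inner ℝ x n * (inner ℝ v y) ^ 2 / (1 - inner ℝ x y) ^ 3) := by
  have hx0 : x ≠ 0 := norm_ne_zero_iff.1 (by simp [hx])
  have hmem : (x, y, n, w) ∈ kernelDomain (fun p : E3 × E3 × ℝ => p.1) :=
    ⟨hx0, by simpa [hx] using hy⟩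
  have hG : ContDiffAt ℝ 2 (fun X => dipoleKernel (X, y, n, w)) x :=
    ((contDiffOn_dipoleKernel.contDiffAt ((isOpen_kernelDomain continuous_fst).mem_nhds hmem)).comp
      (f := fun X => (X, y, n, w)) x (by fun_prop)).of_le two_le_infty
  set a : ℝ := inner ℝ x y with ha
  set b : ℝ := inner ℝ v y with hb
  set m : ℝ := inner ℝ x n with hm
  set k : ℝ := inner ℝ v n with hk
  set Z : ℝ → ℝ := fun r => (√(1 + r ^ 2))⁻¹ * (a + r * b) with hZ
  set N : ℝ → ℝ := fun r => (√(1 + r ^ 2))⁻¹ * (m + r * k) with hN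
  have hZ0 : Z 0 = a := by simp [hZ]
  have hN0 : N 0 = m := by simp [hN]
  have hne : ∀ᶠ r in 𝓝 (0 : ℝ), 1 - Z r ≠ 0 :=
    ((hasDerivAt_proj a b 0).continuousAt.const_sub 1).eventually_ne
      (by simpa using sub_ne_zero.2 hy.symm)
  have hfun : (fun r : ℝ => dipoleKernel (x + r • v, y, n, w)) =
      fun r => w * (1 / (4 * Real.pi) * (N r / (1 - Z r))) := by
    ext r
    simp only [dipoleKernel, inner_proj_tangentLine hx hv hxv, hZ, hN, ha, hb, hm, hk]
  refine iteratedFDeriv_two_diag_eq hG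
    (φ := fun r => w * (1 / (4 * Real.pi) *
      ((projDeriv m k r * (1 - Z r) - N r * -projDeriv a b r) / (1 - Z r) ^ 2))) ?_ ?_
  · rw [hfun]
    filter_upwards [hne] with r hr
    exact (((hasDerivAt_proj m k r).div ((hasDerivAt_proj a b r).const_sub 1) hr).const_mul
      _).const_mul w
  · have hD : 1 - Z 0 ≠ 0 := hne.self_of_nhds
    have hdZ := (hasDerivAt_proj a b 0).const_sub 1
    have := (((((hasDerivAt_projDeriv_zero m k).mul hdZ).sub ((hasDerivAt_proj m k 0).mul
      (hasDerivAt_projDeriv_zero a b).neg)).div (hdZ.pow 2) (pow_ne_zero 2 hD)).const_mul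
      (1 / (4 * Real.pi))).const_mul w
    refine HasDerivAt.congr_deriv (f := fun r => w * (1 / (4 * Real.pi) *
      ((projDeriv m k r * (1 - Z r) - N r * -projDeriv a b r) / (1 - Z r) ^ 2))) this ?_
    simp only [projDeriv_zero, Pi.neg_apply, Pi.sub_apply, Pi.mul_apply, Pi.pow_apply]
    change w * (1 / (4 * Real.pi) * (((-m * (1 - Z 0) + k * -b - (k * -b + N 0 * - -a)) *
      (1 - Z 0) ^ 2 - (k * (1 - Z 0) - N 0 * -b) * ((2 : ℕ) * (1 - Z 0) ^ (2 - 1) * -b)) /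
        ((1 - Z 0) ^ 2) ^ 2)) = _
    rw [hZ0] at hD ⊢
    rw [hN0]
    push_cast
    field_simp
    ring

end GreatCircle

/-! ### Laplacians of the kernels -/

/-- The second derivative in the radial direction of a function that is constant along rays. -/
theorem iteratedFDeriv_two_radial {x : E3} {G : E3 → ℝ}
    (hG : ContDiffAt ℝ 2 G x) (hc : ∀ r : ℝ, 0 < r → G (r • x) = G x) :
    iteratedFDeriv ℝ 2 G x ![x, x] = 0 := by
  refine iteratedFDeriv_two_diag_eq hG (φ := fun _ => 0) ?_ (hasDerivAt_const _ _)
  have h1 : ∀ᶠ r in 𝓝 (0 : ℝ), -1 < r := lt_mem_nhds (by norm_num)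
  filter_upwards [h1] with r hr
  refine (hasDerivAt_const r (G x)).congr_of_eventuallyEq ?_
  filter_upwards [lt_mem_nhds hr] with q hq
  rw [← hc (1 + q) (by linarith), add_smul, one_smul]

theorem norm_inv_smul_smul {x : E3} {r : ℝ} (hr : 0 < r) :
    ‖r • x‖⁻¹ • r • x = ‖x‖⁻¹ • x := by
  rw [norm_smul, Real.norm_of_nonneg hr.le, smul_smul, mul_inv, mul_right_comm,
    inv_mul_cancel₀ hr.ne', one_mul]

/-- Orthonormal bases of three-space that start with a given unit vector. -/
theorem exists_orthonormalBasis_zero_eq {x : E3} (hx : ‖x‖ = 1) :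
    ∃ b : OrthonormalBasis (Fin 3) ℝ E3, b 0 = x := by
  have ho : Orthonormal ℝ (({0} : Set (Fin 3)).domRestrict fun _ => x) := by
    refine ⟨fun _ => hx, fun i j hij => absurd (Subsingleton.elim i j) hij⟩
  obtain ⟨b, hb⟩ := ho.exists_orthonormalBasis_extension_of_card_eq (by simp)
  exact ⟨b, hb 0 rfl⟩

/-- The radial direction contributes nothing. Parseval gives b₁² + b₂² = 1 - a² for the tangential
ones, and (1-a²)/(1-a)² - 2a/(1-a) = 1. -/
theorem laplacian_logKernel {x y : E3} (hx : ‖x‖ = 1) (hy : ‖y‖ = 1) (w : ℝ)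
    (hxy : inner ℝ x y ≠ (1 : ℝ)) :
    (Laplacian.laplacian (fun X => logKernel (X, y, w)) : E3 → ℝ) x = 1 / (4 * Real.pi) * w := by
  obtain ⟨b, hb⟩ := exists_orthonormalBasis_zero_eq hx
  have hx0 : x ≠ 0 := norm_ne_zero_iff.1 (by simp [hx])
  have hmem : (x, y, w) ∈ kernelDomain (fun p : E3 × ℝ => p.1) := ⟨hx0, by simpa [hx] using hxy⟩
  have hG : ContDiffAt ℝ 2 (fun X => logKernel (X, y, w)) x :=
    ((contDiffOn_logKernel.contDiffAt ((isOpen_kernelDomain continuous_fst).mem_nhds hmem)).comp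
      (f := fun X => (X, y, w)) x (by fun_prop)).of_le two_le_infty
  rw [InnerProductSpace.laplacian_eq_iteratedFDeriv_orthonormalBasis _ b]
  have h1 : inner ℝ (b 0) (b 1) = (0 : ℝ) := b.orthonormal.2 (show (0 : Fin 3) ≠ 1 by decide)
  have h2 : inner ℝ (b 0) (b 2) = (0 : ℝ) := b.orthonormal.2 (show (0 : Fin 3) ≠ 2 by decide)
  have hp := b.sum_inner_mul_inner y y
  have h0 : iteratedFDeriv ℝ 2 (fun X => logKernel (X, y, w)) x ![b 0, b 0] = 0 := by
    rw [hb]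
    exact iteratedFDeriv_two_radial hG fun r hr => by simp only [logKernel, norm_inv_smul_smul hr]
  simp only [Fin.sum_univ_three] at hp ⊢
  rw [hb] at h1 h2 hp
  rw [h0, iteratedFDeriv_logKernel_tangent hx (b.orthonormal.1 1) h1 w hxy,
    iteratedFDeriv_logKernel_tangent hx (b.orthonormal.1 2) h2 w hxy]
  rw [real_inner_self_eq_norm_sq, hy] at hp
  simp only [real_inner_comm _ y] at hp
  have hD : 1 - inner ℝ x y ≠ (0 : ℝ) := sub_ne_zero.2 hxy.symm
  generalize (inner ℝ x y : ℝ) = a at *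
  generalize (inner ℝ (b 1) y : ℝ) = b1 at *
  generalize (inner ℝ (b 2) y : ℝ) = b2 at *
  have : b1 ^ 2 / (1 - a) ^ 2 - a / (1 - a) + (b2 ^ 2 / (1 - a) ^ 2 - a / (1 - a)) = 1 := by
    have h5 : b2 ^ 2 = 1 - a ^ 2 - b1 ^ 2 := by linarith
    rw [h5]
    field_simp
    ring
  linear_combination (1 / (4 * Real.pi) * w) * this

/-- Parseval for (y,y) and (y,n) gives b₁² + b₂² = 1 - a² and b₁k₁ + b₂k₂ = -am, the latter because
n ⊥ y. The sum is then (-2m - 2am + 2m(1+a))/(1-a)² = 0. -/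
theorem laplacian_dipoleKernel {x y n : E3} (hx : ‖x‖ = 1) (hy : ‖y‖ = 1) (w : ℝ)
    (hn : inner ℝ y n = (0 : ℝ)) (hxy : inner ℝ x y ≠ (1 : ℝ)) :
    (Laplacian.laplacian (fun X => dipoleKernel (X, y, n, w)) : E3 → ℝ) x = 0 := by
  obtain ⟨b, hb⟩ := exists_orthonormalBasis_zero_eq hx
  have hx0 : x ≠ 0 := norm_ne_zero_iff.1 (by simp [hx])
  have hmem : (x, y, n, w) ∈ kernelDomain (fun p : E3 × E3 × ℝ => p.1) :=
    ⟨hx0, by simpa [hx] using hxy⟩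
  have hG : ContDiffAt ℝ 2 (fun X => dipoleKernel (X, y, n, w)) x :=
    ((contDiffOn_dipoleKernel.contDiffAt ((isOpen_kernelDomain continuous_fst).mem_nhds hmem)).comp
      (f := fun X => (X, y, n, w)) x (by fun_prop)).of_le two_le_infty
  rw [InnerProductSpace.laplacian_eq_iteratedFDeriv_orthonormalBasis _ b]
  have h1 : inner ℝ (b 0) (b 1) = (0 : ℝ) := b.orthonormal.2 (show (0 : Fin 3) ≠ 1 by decide)
  have h2 : inner ℝ (b 0) (b 2) = (0 : ℝ) := b.orthonormal.2 (show (0 : Fin 3) ≠ 2 by decide)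
  have hp := b.sum_inner_mul_inner y y
  have hq := b.sum_inner_mul_inner y n
  have h0 : iteratedFDeriv ℝ 2 (fun X => dipoleKernel (X, y, n, w)) x ![b 0, b 0] = 0 := by
    rw [hb]
    exact iteratedFDeriv_two_radial hG
      fun r hr => by simp only [dipoleKernel, norm_inv_smul_smul hr]
  simp only [Fin.sum_univ_three] at hp hq ⊢
  rw [hb] at h1 h2 hp hq
  rw [h0, iteratedFDeriv_dipoleKernel_tangent hx (b.orthonormal.1 1) h1 w hxy,
    iteratedFDeriv_dipoleKernel_tangent hx (b.orthonormal.1 2) h2 w hxy]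
  rw [real_inner_self_eq_norm_sq, hy] at hp
  rw [hn] at hq
  simp only [real_inner_comm _ y] at hp hq
  have hD : 1 - inner ℝ x y ≠ (0 : ℝ) := sub_ne_zero.2 hxy.symm
  generalize (inner ℝ x y : ℝ) = a at *
  generalize (inner ℝ x n : ℝ) = m at *
  generalize (inner ℝ (b 1) y : ℝ) = b1 at *
  generalize (inner ℝ (b 2) y : ℝ) = b2 at *
  generalize (inner ℝ (b 1) n : ℝ) = k1 at *
  generalize (inner ℝ (b 2) n : ℝ) = k2 at *
  have : -m / (1 - a) ^ 2 + 2 * k1 * b1 / (1 - a) ^ 2 + 2 * m * b1 ^ 2 / (1 - a) ^ 3 +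
      (-m / (1 - a) ^ 2 + 2 * k2 * b2 / (1 - a) ^ 2 + 2 * m * b2 ^ 2 / (1 - a) ^ 3) = 0 := by
    field_simp
    linear_combination (2 * m) * hp + (2 * (1 - a)) * hq
  linear_combination (w * (1 / (4 * Real.pi))) * this

/-! ### Cross products and orthonormal frames -/

theorem inner_cross_left (a b c : E3) : (inner ℝ (cross a b) c : ℝ) = inner ℝ a (cross b c) := by
  simp [cross, PiLp.inner_apply, Fin.sum_univ_three, crossProduct]
  ring

theorem inner_cross_self_left (a b : E3) : (inner ℝ a (cross a b) : ℝ) = 0 := by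
  simp [cross, PiLp.inner_apply, Fin.sum_univ_three, crossProduct]
  ring

theorem inner_cross_self_right (a b : E3) : (inner ℝ b (cross a b) : ℝ) = 0 := by
  simp [cross, PiLp.inner_apply, Fin.sum_univ_three, crossProduct]
  ring

theorem norm_cross_sq (a b : E3) :
    ‖cross a b‖ ^ 2 = ‖a‖ ^ 2 * ‖b‖ ^ 2 - (inner ℝ a b : ℝ) ^ 2 := by
  simp only [EuclideanSpace.real_norm_sq_eq, Fin.sum_univ_three, PiLp.inner_apply]
  simp [cross, crossProduct]
  ring

theorem contDiff_cross : ContDiff ℝ ∞ fun q : E3 × E3 => cross q.1 q.2 := by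
  unfold cross
  refine (contDiff_piLp _).2 fun i => ?_
  fin_cases i <;> simp [crossProduct] <;> fun_prop

/-- The expansion of a vector in a positively oriented orthonormal frame. -/
theorem eq_sum_inner_cross_frame {a b : E3} (ha : ‖a‖ = 1) (hb : ‖b‖ = 1)
    (hab : inner ℝ a b = (0 : ℝ)) (x : E3) :
    x = (inner ℝ x a : ℝ) • a + (inner ℝ x b : ℝ) • b +
      (inner ℝ x (cross a b) : ℝ) • cross a b := by
  have hc : ‖cross a b‖ = 1 := by
    have := norm_cross_sq a b
    rw [ha, hb, hab] at this
    nlinarith [norm_nonneg (cross a b)]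
  have ho : Orthonormal ℝ ![a, b, cross a b] := by
    refine ⟨fun i => by fin_cases i <;> simp [ha, hb, hc], fun i j hij => ?_⟩
    have hba : inner ℝ b a = (0 : ℝ) := by rw [real_inner_comm, hab]
    have h1 := inner_cross_self_left a b
    have h2 := inner_cross_self_right a b
    have h3 : inner ℝ (cross a b) a = (0 : ℝ) := by rw [real_inner_comm, h1]
    have h4 : inner ℝ (cross a b) b = (0 : ℝ) := by rw [real_inner_comm, h2]
    fin_cases i <;> fin_cases j <;> simp_all
  have hsp : ⊤ ≤ Submodule.span ℝ (range ![a, b, cross a b]) := by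
    rw [ho.linearIndependent.span_eq_top_of_card_eq_finrank (by simp)]
  have := (OrthonormalBasis.mk ho hsp).sum_repr' x
  simp only [Fin.sum_univ_three, OrthonormalBasis.coe_mk] at this
  simpa [real_inner_comm _ x] using this.symm

theorem one_sub_inner_eq {x y : E3} (hx : ‖x‖ = 1) (hy : ‖y‖ = 1) :
    1 - (inner ℝ x y : ℝ) = ‖x - y‖ ^ 2 / 2 := by
  rw [norm_sub_sq_real, hx, hy]
  ring

/-! ### Geometry of the curve: frame, Taylor and chord-arc estimates -/

namespace SphCurve

noncomputable section

variable (Γ : SphCurve)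

/-- The curve as a map to Euclidean space. -/
def pos (s : ℝ) : E3 := (Γ.toFun s : E3)

/-- The surface normal of the curve, pointing to the left. -/
def normal (s : ℝ) : E3 := cross (Γ.pos s) (Γ.tangent s)

theorem contDiff_pos : ContDiff ℝ 2 Γ.pos := Γ.contDiff

theorem continuous_pos : Continuous Γ.pos := Γ.contDiff_pos.continuous

theorem continuous_toFun : Continuous Γ.toFun := continuous_induced_rng.2 Γ.continuous_pos

theorem hasDerivAt_pos (s : ℝ) : HasDerivAt Γ.pos (Γ.tangent s) s :=
  (Γ.contDiff_pos.differentiable (by norm_num) s).hasDerivAt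

theorem contDiff_tangent : ContDiff ℝ 1 Γ.tangent := by
  have h : ContDiff ℝ (1 + 1) Γ.pos := by
    rw [one_add_one_eq_two]
    exact Γ.contDiff_pos
  exact (contDiff_succ_iff_deriv.1 h).2.2

theorem continuous_tangent : Continuous Γ.tangent := Γ.contDiff_tangent.continuous

theorem continuous_normal : Continuous Γ.normal :=
  contDiff_cross.continuous.comp (Γ.continuous_pos.prodMk Γ.continuous_tangent)

@[simp] theorem norm_pos (s : ℝ) : ‖Γ.pos s‖ = 1 := norm_eq_of_mem_sphere (Γ.toFun s)

@[simp] theorem norm_tangent (s : ℝ) : ‖Γ.tangent s‖ = 1 := Γ.unit_speed s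

theorem inner_pos_tangent (s : ℝ) : inner ℝ (Γ.pos s) (Γ.tangent s) = (0 : ℝ) := by
  have h1 : HasDerivAt (fun s => (inner ℝ (Γ.pos s) (Γ.pos s) : ℝ)) _ s :=
    (Γ.hasDerivAt_pos s).inner ℝ (Γ.hasDerivAt_pos s)
  have h2 : (fun s => (inner ℝ (Γ.pos s) (Γ.pos s) : ℝ)) = fun _ => 1 := by
    ext s
    rw [real_inner_self_eq_norm_sq, norm_pos, one_pow]
  rw [h2] at h1
  have := h1.unique (hasDerivAt_const s 1)
  rw [real_inner_comm (Γ.pos s) (Γ.tangent s)] at this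
  linarith

@[simp] theorem norm_normal (s : ℝ) : ‖Γ.normal s‖ = 1 := by
  have := norm_cross_sq (Γ.pos s) (Γ.tangent s)
  rw [inner_pos_tangent, norm_pos, norm_tangent] at this
  have h : ‖Γ.normal s‖ ^ 2 = 1 := by
    rw [normal, this]
    norm_num
  nlinarith [norm_nonneg (Γ.normal s)]

theorem inner_pos_normal (s : ℝ) : inner ℝ (Γ.pos s) (Γ.normal s) = (0 : ℝ) :=
  inner_cross_self_left _ _

theorem inner_tangent_normal (s : ℝ) : inner ℝ (Γ.tangent s) (Γ.normal s) = (0 : ℝ) :=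
  inner_cross_self_right _ _

theorem periodic_pos : Function.Periodic Γ.pos Γ.length := fun s => by
  rw [pos, Γ.periodic s, pos]

theorem periodic_tangent : Function.Periodic Γ.tangent Γ.length := fun s => by
  have h : (fun r => Γ.pos (r + Γ.length)) = Γ.pos := funext Γ.periodic_pos
  have := deriv_comp_add_const Γ.pos Γ.length s
  rw [h] at this
  exact this.symm

theorem periodic_normal : Function.Periodic Γ.normal Γ.length := fun s => by
  rw [normal, Γ.periodic_pos, Γ.periodic_tangent, normal]

/-- The derivative of the tangent is continuous and periodic, hence bounded, so the tangent is
Lipschitz; the mean value inequality does the rest. -/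
theorem exists_taylor_bound :
    ∃ M : ℝ, 0 < M ∧ ∀ s h, ‖Γ.pos (s + h) - Γ.pos s - h • Γ.tangent s‖ ≤ M * h ^ 2 := by
  have hdc : Continuous (deriv Γ.tangent) := Γ.contDiff_tangent.continuous_deriv (by norm_num)
  have hdp : Function.Periodic (deriv Γ.tangent) Γ.length := fun s => by
    have h : (fun r => Γ.tangent (r + Γ.length)) = Γ.tangent := funext Γ.periodic_tangent
    have := deriv_comp_add_const Γ.tangent Γ.length s
    rw [h] at this
    exact this.symm
  obtain ⟨M, hM⟩ := (hdp.compact_of_continuous Γ.length_pos.ne' hdc).isBounded.exists_norm_le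
  have hM' : ∀ s, ‖deriv Γ.tangent s‖ ≤ M := fun s => hM _ (mem_range_self s)
  have hM0 : 0 ≤ M := (norm_nonneg _).trans (hM' 0)
  have hlip : ∀ a b, ‖Γ.tangent b - Γ.tangent a‖ ≤ M * ‖b - a‖ := fun a b =>
    Convex.norm_image_sub_le_of_norm_deriv_le (s := univ)
      (fun r _ => Γ.contDiff_tangent.differentiable (by norm_num) r) (fun r _ => hM' r)
      convex_univ (mem_univ a) (mem_univ b)
  -- Only M ≥ 0 is known; adding 1 makes the constant positive.
  refine ⟨M + 1, by linarith, fun s h => ?_⟩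
  have hd : ∀ r ∈ uIcc (0 : ℝ) h, HasDerivWithinAt (fun r => Γ.pos (s + r) - r • Γ.tangent s)
      (Γ.tangent (s + r) - Γ.tangent s) (uIcc 0 h) r := fun r _ => by
    have h1 : HasDerivAt (fun r => Γ.pos (s + r)) (Γ.tangent (s + r)) r :=
      HasDerivAt.comp_const_add s r (Γ.hasDerivAt_pos (s + r))
    have h2 : HasDerivAt (fun r : ℝ => r • Γ.tangent s) (Γ.tangent s) r := by
      simpa using (hasDerivAt_id r).smul_const (Γ.tangent s)
    exact (h1.sub h2).hasDerivWithinAt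
  have hb : ∀ r ∈ uIcc (0 : ℝ) h, ‖Γ.tangent (s + r) - Γ.tangent s‖ ≤ M * |h| := fun r hr => by
    refine (hlip _ _).trans (mul_le_mul_of_nonneg_left ?_ hM0)
    have := abs_sub_left_of_mem_uIcc hr
    simpa using this
  have := (convex_uIcc 0 h).norm_image_sub_le_of_norm_hasDerivWithin_le hd hb
    left_mem_uIcc right_mem_uIcc
  simp only [add_zero, zero_smul, sub_zero, Real.norm_eq_abs] at this
  calc _ = ‖Γ.pos (s + h) - h • Γ.tangent s - Γ.pos s‖ := by congr 1; abel
    _ ≤ M * |h| * |h| := this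
    _ ≤ (M + 1) * h ^ 2 := by rw [mul_assoc, abs_mul_abs_self]; nlinarith [sq_nonneg h]

/-- A constant for the second order Taylor estimate of the curve. -/
def taylorConst : ℝ := Γ.exists_taylor_bound.choose

theorem taylorConst_pos : 0 < Γ.taylorConst := Γ.exists_taylor_bound.choose_spec.1

theorem norm_taylor_le (s h : ℝ) :
    ‖Γ.pos (s + h) - Γ.pos s - h • Γ.tangent s‖ ≤ Γ.taylorConst * h ^ 2 :=
  Γ.exists_taylor_bound.choose_spec.2 s h

/-- Position and tangent at s are orthogonal to the normal, which therefore sees only the second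
order remainder. -/
theorem abs_inner_pos_add_normal_le (s h : ℝ) :
    |(inner ℝ (Γ.pos (s + h)) (Γ.normal s) : ℝ)| ≤ Γ.taylorConst * h ^ 2 := by
  have h1 : (inner ℝ (Γ.pos (s + h)) (Γ.normal s) : ℝ) =
      inner ℝ (Γ.pos (s + h) - Γ.pos s - h • Γ.tangent s) (Γ.normal s) := by
    simp [inner_sub_left, real_inner_smul_left, inner_pos_normal, inner_tangent_normal]
  rw [h1]
  refine (abs_real_inner_le_norm _ _).trans ?_
  rw [norm_normal, mul_one]
  exact Γ.norm_taylor_le s h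

theorem abs_inner_pos_normal_add_le (s h : ℝ) :
    |(inner ℝ (Γ.pos s) (Γ.normal (s + h)) : ℝ)| ≤ Γ.taylorConst * h ^ 2 := by
  simpa using Γ.abs_inner_pos_add_normal_le (s + h) (-h)

theorem abs_norm_pos_add_sub_le (s h : ℝ) :
    abs (‖Γ.pos (s + h) - Γ.pos s‖ - |h|) ≤ Γ.taylorConst * h ^ 2 := by
  have h1 : |h| = ‖h • Γ.tangent s‖ := by simp [norm_smul]
  rw [h1]
  exact (abs_norm_sub_norm_le _ _).trans (Γ.norm_taylor_le s h)

/-- Reduced to one period, equal values force h to be an integer multiple of the length, and |h| <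
length leaves only 0. -/
theorem toFun_add_ne {s h : ℝ} (h0 : h ≠ 0) (hL : |h| < Γ.length) :
    Γ.toFun (s + h) ≠ Γ.toFun s := by
  intro he
  have hm : ∀ r, Γ.toFun (toIcoMod Γ.length_pos 0 r) = Γ.toFun r := fun r => by
    rw [toIcoMod]
    exact Γ.periodic.sub_zsmul_eq _
  have hI : ∀ r, toIcoMod Γ.length_pos 0 r ∈ Ico 0 Γ.length := fun r => by
    simpa using toIcoMod_mem_Ico Γ.length_pos 0 r
  have h1 := Γ.injOn (hI _) (hI _) ((hm (s + h)).trans (he.trans (hm s).symm))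
  obtain ⟨k, hk⟩ := (toIcoMod_eq_toIcoMod Γ.length_pos).1 h1
  have hk' : h = -(k * Γ.length) := by
    rw [zsmul_eq_mul] at hk
    linarith
  rw [hk', abs_neg, abs_mul, abs_of_pos Γ.length_pos] at hL
  have hk1 : |(k : ℝ)| < 1 := by
    by_contra hcon
    nlinarith [Γ.length_pos]
  have hk0 : k = 0 := by
    rw [← Int.cast_abs] at hk1
    exact Int.abs_lt_one_iff.1 (by exact_mod_cast hk1)
  exact h0 (by rw [hk', hk0]; simp)

/-- Near the diagonal the chord is |h| up to a quadratic error; away from it the chord has a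
positive minimum by compactness and injectivity. Half a period keeps h from reaching the next copy
of the same point. -/
theorem exists_chord_bound :
    ∃ c : ℝ, 0 < c ∧ ∀ s h, |h| ≤ Γ.length / 2 → c * |h| ≤ ‖Γ.pos (s + h) - Γ.pos s‖ := by
  have hM := Γ.taylorConst_pos
  have hL := Γ.length_pos
  -- For |h| < d the Taylor error is at most |h|/2.
  set d : ℝ := 1 / (2 * Γ.taylorConst) with hd
  have hd0 : 0 < d := by positivity
  set K : Set (ℝ × ℝ) := Icc 0 Γ.length ×ˢ (Icc (-(Γ.length / 2)) (Γ.length / 2) ∩ {h | d ≤ |h|})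
    with hK
  have hKc : IsCompact K := isCompact_Icc.prod
    (isCompact_Icc.inter_right (isClosed_le continuous_const continuous_abs))
  have hf : Continuous fun q : ℝ × ℝ => ‖Γ.pos (q.1 + q.2) - Γ.pos q.1‖ :=
    ((Γ.continuous_pos.comp (by fun_prop)).sub (Γ.continuous_pos.comp (by fun_prop))).norm
  obtain ⟨m, hm0, hm⟩ : ∃ m : ℝ, 0 < m ∧ ∀ q ∈ K, m ≤ ‖Γ.pos (q.1 + q.2) - Γ.pos q.1‖ := by
    rcases K.eq_empty_or_nonempty with he | hne
    · exact ⟨1, one_pos, fun q hq => by simp [he] at hq⟩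
    · obtain ⟨q, hq, hmin⟩ := hKc.exists_isMinOn hne hf.continuousOn
      refine ⟨_, ?_, fun r hr => hmin hr⟩
      rw [norm_pos_iff, sub_ne_zero]
      intro he
      refine Γ.toFun_add_ne (s := q.1) (h := q.2) ?_ ?_ (Subtype.ext he)
      · intro h0
        have : d ≤ |q.2| := hq.2.2
        rw [h0, abs_zero] at this
        linarith
      · have := abs_le.2 hq.2.1
        linarith
  refine ⟨min (1 / 2) (m / Γ.length), lt_min (by norm_num) (by positivity), fun s h hh => ?_⟩
  by_cases hc : |h| < d
  · have h1 := (abs_le.1 (Γ.abs_norm_pos_add_sub_le s h)).1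
    have h2 : Γ.taylorConst * |h| ≤ 1 / 2 := by
      rw [hd, lt_div_iff₀ (by positivity)] at hc
      linarith
    have h3 : Γ.taylorConst * h ^ 2 ≤ 1 / 2 * |h| := by
      rw [← sq_abs, pow_two, ← mul_assoc]
      exact mul_le_mul_of_nonneg_right h2 (abs_nonneg h)
    have h4 : min (1 / 2) (m / Γ.length) * |h| ≤ 1 / 2 * |h| :=
      mul_le_mul_of_nonneg_right (min_le_left _ _) (abs_nonneg h)
    linarith
  · set r := toIcoMod hL 0 s with hr
    have hr1 : r ∈ Icc 0 Γ.length := by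
      have := toIcoMod_mem_Ico hL 0 s
      exact ⟨this.1, by simpa using this.2.le⟩
    have hr2 : ∀ a, Γ.pos (r + a) = Γ.pos (s + a) := fun a => by
      rw [hr, toIcoMod, sub_add_eq_add_sub]
      exact Γ.periodic_pos.sub_zsmul_eq _
    have := hm (r, h) ⟨hr1, abs_le.1 hh, not_lt.1 hc⟩
    have h0 := hr2 0
    rw [add_zero, add_zero] at h0
    simp only [hr2, h0] at this
    refine le_trans ?_ this
    calc _ ≤ m / Γ.length * |h| := mul_le_mul_of_nonneg_right (min_le_right _ _) (abs_nonneg h)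
      _ ≤ m / Γ.length * Γ.length := by gcongr; linarith
      _ = m := by field_simp

/-- A chord-arc constant of the curve. -/
def chordConst : ℝ := Γ.exists_chord_bound.choose

theorem chordConst_pos : 0 < Γ.chordConst := Γ.exists_chord_bound.choose_spec.1

theorem chord_le {s h : ℝ} (hh : |h| ≤ Γ.length / 2) :
    Γ.chordConst * |h| ≤ ‖Γ.pos (s + h) - Γ.pos s‖ :=
  Γ.exists_chord_bound.choose_spec.2 s h hh

theorem isCompact_trace : IsCompact Γ.trace :=
  Γ.periodic.compact_of_continuous Γ.length_pos.ne' Γ.continuous_toFun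

/-! ### Foot points -/

/-- The parameter within half a period of `s₀` of a point of the curve nearest to `x`. -/
theorem exists_foot (s₀ : ℝ) (x : Sph) : ∃ r, |r - s₀| ≤ Γ.length / 2 ∧
    ∀ s, inner ℝ (x : E3) (Γ.pos s) ≤ (inner ℝ (x : E3) (Γ.pos r) : ℝ) := by
  have hL := Γ.length_pos
  have hf : Continuous fun s => (inner ℝ (x : E3) (Γ.pos s) : ℝ) :=
    continuous_const.inner Γ.continuous_pos
  obtain ⟨r, hr, hmax⟩ := (isCompact_Icc (a := s₀ - Γ.length / 2)
    (b := s₀ + Γ.length / 2)).exists_isMaxOn ⟨s₀, by constructor <;> linarith⟩ hf.continuousOn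
  refine ⟨r, abs_le.2 ⟨by linarith [hr.1], by linarith [hr.2]⟩, fun s => ?_⟩
  have h1 := toIcoMod_mem_Ico hL (s₀ - Γ.length / 2) s
  have h2 : Γ.pos (toIcoMod hL (s₀ - Γ.length / 2) s) = Γ.pos s := by
    rw [toIcoMod]
    exact Γ.periodic_pos.sub_zsmul_eq _
  rw [← h2]
  exact hmax ⟨h1.1, by linarith [h1.2]⟩

/-- The parameter within half a period of `s₀` of a point of the curve nearest to `x`. -/
def foot (s₀ : ℝ) (x : Sph) : ℝ := (Γ.exists_foot s₀ x).choose

theorem abs_foot_sub_le (s₀ : ℝ) (x : Sph) : |Γ.foot s₀ x - s₀| ≤ Γ.length / 2 :=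
  (Γ.exists_foot s₀ x).choose_spec.1

theorem inner_le_inner_foot (s₀ : ℝ) (x : Sph) (s : ℝ) :
    inner ℝ (x : E3) (Γ.pos s) ≤ (inner ℝ (x : E3) (Γ.pos (Γ.foot s₀ x)) : ℝ) :=
  (Γ.exists_foot s₀ x).choose_spec.2 s

/-- First order condition at the maximum of ⟨x, p(s)⟩, which is taken over all parameters and so is
interior. -/
theorem inner_foot_tangent (s₀ : ℝ) (x : Sph) :
    inner ℝ (x : E3) (Γ.tangent (Γ.foot s₀ x)) = (0 : ℝ) := by
  have hmax : IsLocalMax (fun s => (inner ℝ (x : E3) (Γ.pos s) : ℝ)) (Γ.foot s₀ x) :=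
    Eventually.of_forall fun s => Γ.inner_le_inner_foot s₀ x s
  have hd : HasDerivAt (fun s => (inner ℝ (x : E3) (Γ.pos s) : ℝ)) _ (Γ.foot s₀ x) :=
    (hasDerivAt_const _ (x : E3)).inner ℝ (Γ.hasDerivAt_pos (Γ.foot s₀ x))
  simpa using hmax.hasDerivAt_eq_zero hd

theorem norm_sph (x : Sph) : ‖(x : E3)‖ = 1 := norm_eq_of_mem_sphere x

theorem norm_sub_foot_le (s₀ : ℝ) (x : Sph) (s : ℝ) :
    ‖(x : E3) - Γ.pos (Γ.foot s₀ x)‖ ≤ ‖(x : E3) - Γ.pos s‖ := by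
  have h := Γ.inner_le_inner_foot s₀ x s
  have h1 := one_sub_inner_eq (norm_sph x) (Γ.norm_pos s)
  have h2 := one_sub_inner_eq (norm_sph x) (Γ.norm_pos (Γ.foot s₀ x))
  exact (sq_le_sq₀ (norm_nonneg _) (norm_nonneg _)).1 (by linarith)

/-- Triangle inequality through x: the foot is no farther from x than any other point of the curve.
-/
theorem chord_le_two_mul {s₀ : ℝ} (x : Sph) {h : ℝ} (hh : |h| ≤ Γ.length / 2) :
    Γ.chordConst * |h| ≤ 2 * ‖(x : E3) - Γ.pos (Γ.foot s₀ x + h)‖ := by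
  have h1 := Γ.chord_le (s := Γ.foot s₀ x) hh
  have h2 := Γ.norm_sub_foot_le s₀ x (Γ.foot s₀ x + h)
  have h3 := norm_sub_le_norm_sub_add_norm_sub (Γ.pos (Γ.foot s₀ x + h)) (x : E3)
    (Γ.pos (Γ.foot s₀ x))
  rw [norm_sub_rev _ (x : E3)] at h3
  linarith

/-- The denominator of the kernels is bounded below by the squared distance to the foot. -/
theorem sq_le_one_sub_inner {s₀ : ℝ} (x : Sph) {h : ℝ} (hh : |h| ≤ Γ.length / 2) :
    Γ.chordConst ^ 2 / 8 * h ^ 2 ≤ 1 - inner ℝ (x : E3) (Γ.pos (Γ.foot s₀ x + h)) := by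
  have h1 := Γ.chord_le_two_mul (s₀ := s₀) x hh
  rw [one_sub_inner_eq (norm_sph x) (Γ.norm_pos _)]
  have h2 : (Γ.chordConst * |h|) ^ 2 ≤ (2 * ‖(x : E3) - Γ.pos (Γ.foot s₀ x + h)‖) ^ 2 :=
    pow_le_pow_left₀ (mul_nonneg Γ.chordConst_pos.le (abs_nonneg h)) h1 2
  rw [mul_pow, mul_pow, sq_abs] at h2
  linarith

theorem eq_foot_frame (s₀ : ℝ) (x : Sph) :
    (x : E3) = (inner ℝ (x : E3) (Γ.pos (Γ.foot s₀ x)) : ℝ) • Γ.pos (Γ.foot s₀ x) +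
      (inner ℝ (x : E3) (Γ.normal (Γ.foot s₀ x)) : ℝ) • Γ.normal (Γ.foot s₀ x) := by
  have := eq_sum_inner_cross_frame (Γ.norm_pos _) (Γ.norm_tangent _)
    (Γ.inner_pos_tangent (Γ.foot s₀ x)) (x : E3)
  rwa [inner_foot_tangent, zero_smul, add_zero] at this

theorem sq_add_sq_foot (s₀ : ℝ) (x : Sph) :
    (inner ℝ (x : E3) (Γ.pos (Γ.foot s₀ x)) : ℝ) ^ 2 +
      (inner ℝ (x : E3) (Γ.normal (Γ.foot s₀ x)) : ℝ) ^ 2 = 1 := by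
  have h1 := congrArg (fun y : E3 => (inner ℝ (x : E3) y : ℝ)) (Γ.eq_foot_frame s₀ x)
  simp only [inner_add_right, real_inner_smul_right, real_inner_self_eq_norm_sq, norm_sph] at h1
  linarith

/-- The foot is an arbitrary choice among nearest points, but the chord-arc inequality bounds its
parameter distance to s₀ by (2/c)‖x - p(s₀)‖. -/
theorem tendsto_foot (s₀ : ℝ) :
    Tendsto (Γ.foot s₀) (𝓝 (Γ.toFun s₀)) (𝓝 s₀) := by
  have hc := Γ.chordConst_pos
  rw [tendsto_iff_norm_sub_tendsto_zero]
  have hb : ∀ x, ‖Γ.foot s₀ x - s₀‖ ≤ 2 / Γ.chordConst * ‖(x : E3) - Γ.pos s₀‖ := fun x => by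
    have h1 := Γ.chord_le (s := s₀) (Γ.abs_foot_sub_le s₀ x)
    rw [add_sub_cancel] at h1
    have h2 := Γ.norm_sub_foot_le s₀ x s₀
    have h3 := norm_sub_le_norm_sub_add_norm_sub (Γ.pos (Γ.foot s₀ x)) (x : E3) (Γ.pos s₀)
    rw [norm_sub_rev _ (x : E3)] at h3
    rw [Real.norm_eq_abs, div_mul_eq_mul_div, le_div_iff₀ hc]
    linarith
  refine squeeze_zero (fun x => norm_nonneg _) hb ?_
  have hcont : Continuous fun x : Sph => 2 / Γ.chordConst * ‖(x : E3) - Γ.pos s₀‖ := by fun_prop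
  have := hcont.tendsto (Γ.toFun s₀)
  simpa [pos] using this

theorem tendsto_inner_pos_foot (s₀ : ℝ) :
    Tendsto (fun x : Sph => (inner ℝ (x : E3) (Γ.pos (Γ.foot s₀ x)) : ℝ)) (𝓝 (Γ.toFun s₀))
      (𝓝 1) := by
  have h1 : Tendsto (fun x : Sph => (x : E3)) (𝓝 (Γ.toFun s₀)) (𝓝 (Γ.pos s₀)) :=
    continuous_subtype_val.tendsto _
  have := h1.inner (𝕜 := ℝ) ((Γ.continuous_pos.tendsto s₀).comp (Γ.tendsto_foot s₀))
  simpa [real_inner_self_eq_norm_sq] using this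

theorem tendsto_inner_normal_foot (s₀ : ℝ) :
    Tendsto (fun x : Sph => (inner ℝ (x : E3) (Γ.normal (Γ.foot s₀ x)) : ℝ)) (𝓝 (Γ.toFun s₀))
      (𝓝 0) := by
  have h1 : Tendsto (fun x : Sph => (x : E3)) (𝓝 (Γ.toFun s₀)) (𝓝 (Γ.pos s₀)) :=
    continuous_subtype_val.tendsto _
  have := h1.inner (𝕜 := ℝ) ((Γ.continuous_normal.tendsto s₀).comp (Γ.tendsto_foot s₀))
  simpa [inner_pos_normal] using this

end

end SphCurve

/-! ### Functions on the sphere and their radial extensions -/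

theorem inner_sph_ne_one {x y : Sph} (h : x ≠ y) : inner ℝ (x : E3) (y : E3) ≠ (1 : ℝ) :=
  fun he => h (Subtype.ext ((inner_eq_one_iff_of_norm_eq_one (norm_eq_of_mem_sphere x)
    (norm_eq_of_mem_sphere y)).1 he))

theorem Sph.ne_zero (x : Sph) : (x : E3) ≠ 0 :=
  norm_ne_zero_iff.1 (by simp [norm_eq_of_mem_sphere x])

namespace Sph

theorem radialExt_of_ne {u : Sph → ℝ} {Y : E3} (hY : Y ≠ 0) :
    radialExt u Y = u ⟨‖Y‖⁻¹ • Y, norm_inv_smul_mem_sphere hY⟩ := dif_pos hY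

@[simp] theorem radialExt_coe (u : Sph → ℝ) (x : Sph) : radialExt u (x : E3) = u x := by
  rw [radialExt_of_ne x.ne_zero]
  congr 1
  exact Subtype.ext (by simp [norm_eq_of_mem_sphere x])

theorem eventually_proj_mem {S : Set Sph} (hS : IsOpen S) {x : Sph} (hx : x ∈ S) :
    ∀ᶠ Y in 𝓝 (x : E3), ∃ hY : Y ≠ 0,
      (⟨‖Y‖⁻¹ • Y, norm_inv_smul_mem_sphere hY⟩ : Sph) ∈ S := by
  obtain ⟨O, hO, rfl⟩ := isOpen_induced_iff.1 hS
  have hc : ContinuousAt (fun Y : E3 => ‖Y‖⁻¹ • Y) x :=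
    (contDiffAt_norm_inv_smul x.ne_zero).continuousAt
  have hm : ‖(x : E3)‖⁻¹ • (x : E3) ∈ O := by
    rw [norm_eq_of_mem_sphere x]
    simpa using hx
  filter_upwards [eventually_ne_nhds x.ne_zero, hc.eventually (hO.mem_nhds hm)] with Y hY hYO
  exact ⟨hY, hYO⟩

/-- A function that agrees on an open set with a ray-invariant function has that function as its
radial extension. -/
theorem radialExt_eventuallyEq {S : Set Sph} (hS : IsOpen S) {x : Sph} (hx : x ∈ S)
    {u : Sph → ℝ} {H : E3 → ℝ} (hu : ∀ y ∈ S, u y = H y)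
    (hH : ∀ Y : E3, Y ≠ 0 → H (‖Y‖⁻¹ • Y) = H Y) : radialExt u =ᶠ[𝓝 (x : E3)] H := by
  filter_upwards [eventually_proj_mem hS hx] with Y ⟨hY, hYS⟩
  rw [radialExt_of_ne hY, hu _ hYS, hH Y hY]

theorem contMDiffOn_of_eqOn {S : Set Sph} {U : Set E3} {u : Sph → ℝ} {H : E3 → ℝ}
    (hu : ∀ y ∈ S, u y = H y) (hH : ContDiffOn ℝ ∞ H U) (hSU : ∀ y ∈ S, (y : E3) ∈ U) :
    ContMDiffOn (𝓡 2) 𝓘(ℝ, ℝ) ∞ u S :=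
  (hH.contMDiffOn.comp (contMDiff_coe_sphere (n := 2)).contMDiffOn hSU).congr hu

/-- Off the origin the extension is u composed with Y ↦ Y/‖Y‖. Punctured space is treated as an open
submanifold so that this map takes all its values in the sphere. -/
theorem contDiffAt_radialExt {S : Set Sph} (hS : IsOpen S) {u : Sph → ℝ}
    (hu : ContMDiffOn (𝓡 2) 𝓘(ℝ, ℝ) ∞ u S) {x : Sph} (hx : x ∈ S) :
    ContDiffAt ℝ ∞ (radialExt u) (x : E3) := by
  let U : TopologicalSpace.Opens E3 := ⟨{Y | Y ≠ 0}, isOpen_ne⟩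
  have hp : ContMDiff 𝓘(ℝ, E3) 𝓘(ℝ, E3) ∞ fun Y : U => ‖(Y : E3)‖⁻¹ • (Y : E3) := fun Y =>
    (contMDiffAt_subtype_iff (f := fun Y : E3 => ‖Y‖⁻¹ • Y)).2
      (contDiffAt_norm_inv_smul Y.2).contMDiffAt
  have hq := ContMDiff.codRestrict_sphere (n := 2) hp fun Y => norm_inv_smul_mem_sphere Y.2
  have hxU : (x : E3) ∈ U := x.ne_zero
  have hxe : (⟨‖(x : E3)‖⁻¹ • (x : E3), norm_inv_smul_mem_sphere x.ne_zero⟩ : Sph) = x :=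
    Subtype.ext (by simp [norm_eq_of_mem_sphere x])
  have hux : ContMDiffAt (𝓡 2) 𝓘(ℝ, ℝ) ∞ u
      ⟨‖(x : E3)‖⁻¹ • (x : E3), norm_inv_smul_mem_sphere x.ne_zero⟩ := by
    rw [hxe]
    exact hu.contMDiffAt (hS.mem_nhds hx)
  have hc := hux.comp (⟨x, hxU⟩ : U) (hq.contMDiffAt (x := (⟨x, hxU⟩ : U)))
  rw [← contMDiffAt_iff_contDiffAt]
  refine (contMDiffAt_subtype_iff (U := U) (x := ⟨x, hxU⟩)).1 (hc.congr_of_eventuallyEq ?_)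
  exact Eventually.of_forall fun Y => radialExt_of_ne Y.2

theorem logKernel_eq_fundSol (x y : Sph) (w : ℝ) : logKernel (x, y, w) = fundSol x y * w := by
  simp [logKernel, fundSol, norm_eq_of_mem_sphere x, Real.log_abs]

/-- The surface rotation differentiates in the second variable; by symmetry of the inner product the
same kernel serves, with pole x. -/
theorem radialExt_fundSol_eventuallyEq (x y : Sph) :
    radialExt (fun z => fundSol x z) =ᶠ[𝓝 (y : E3)] fun Y => logKernel (Y, x, 1) := by
  filter_upwards [eventually_ne_nhds y.ne_zero] with Y hY
  rw [radialExt_of_ne hY]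
  simp [logKernel, fundSol, Real.log_abs, real_inner_comm (x : E3)]

end Sph

theorem contDiffAt_logKernel {x y : Sph} (w : ℝ) (hxy : x ≠ y) :
    ContDiffAt ℝ ∞ (fun X : E3 => logKernel (X, (y : E3), w)) (x : E3) := by
  have hmem : ((x : E3), (y : E3), w) ∈ kernelDomain fun p : E3 × ℝ => p.1 :=
    ⟨x.ne_zero, by simpa [norm_eq_of_mem_sphere x] using inner_sph_ne_one hxy⟩
  exact (contDiffOn_logKernel.contDiffAt ((isOpen_kernelDomain continuous_fst).mem_nhds
    hmem)).comp (f := fun X => (X, (y : E3), w)) (x : E3) (by fun_prop)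

/-! ### The layer potentials off the curve -/

namespace SphCurve

variable (Γ : SphCurve)

/-- By the triple product, (∇U × e_r)·t = ∇U·(e_r × t), a derivative in the direction of the normal.
It is computed along the tangent line p(s) + r n(s). -/
theorem doubleKernel_eq {x : Sph} {s : ℝ} (hx : Γ.toFun s ≠ x) :
    Γ.doubleKernel x s =
      1 / (4 * Real.pi) * (inner ℝ (x : E3) (Γ.normal s) / (1 - inner ℝ (x : E3) (Γ.pos s))) := by
  have hne : (inner ℝ (Γ.pos s) (x : E3) : ℝ) ≠ 1 := inner_sph_ne_one hx
  rw [doubleKernel, Sph.surfaceCurl, inner_cross_left, Sph.surfaceGradient, gradient,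
    InnerProductSpace.toDual_symm_apply]
  change fderiv ℝ (Sph.radialExt fun y => Sph.fundSol x y) (Γ.pos s) (Γ.normal s) = _
  have hev : Sph.radialExt (fun z => Sph.fundSol x z) =ᶠ[𝓝 (Γ.pos s)]
      fun Y => logKernel (Y, (x : E3), 1) := Sph.radialExt_fundSol_eventuallyEq x (Γ.toFun s)
  have hd : HasFDerivAt (fun Y => logKernel (Y, (x : E3), 1))
      (fderiv ℝ (fun Y => logKernel (Y, (x : E3), 1)) (Γ.pos s)) (Γ.pos s + (0 : ℝ) • Γ.normal s) := by
    rw [zero_smul, add_zero]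
    exact ((contDiffAt_logKernel 1 hx).differentiableAt (by simp)).hasFDerivAt
  have hl : HasDerivAt (fun r : ℝ => Γ.pos s + r • Γ.normal s) (Γ.normal s) 0 := by
    simpa using ((hasDerivAt_id (0 : ℝ)).smul_const (Γ.normal s)).const_add (Γ.pos s)
  have h1 := hd.comp_hasDerivAt (0 : ℝ) hl
  set a : ℝ := inner ℝ (Γ.pos s) (x : E3) with ha
  set b : ℝ := inner ℝ (Γ.normal s) (x : E3) with hb
  have hfun : (fun Y => logKernel (Y, (x : E3), 1)) ∘ (fun r : ℝ => Γ.pos s + r • Γ.normal s) =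
      fun r => (-(1 / (4 * Real.pi)) * Real.log (1 - (√(1 + r ^ 2))⁻¹ * (a + r * b))) * 1 := by
    ext r
    simp only [logKernel, Function.comp_apply, inner_proj_tangentLine (Γ.norm_pos s)
      (Γ.norm_normal s) (Γ.inner_pos_normal s), ha, hb]
  have hne' : 1 - a ≠ 0 := sub_ne_zero.2 hne.symm
  have h2 := ((((hasDerivAt_proj a b 0).const_sub 1).log (by simpa using hne')).const_mul
    (-(1 / (4 * Real.pi)))).mul_const 1
  rw [hfun] at h1
  rw [hev.fderiv_eq, h1.unique h2, projDeriv_zero, real_inner_comm (Γ.normal s),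
    real_inner_comm (Γ.pos s), ← ha, ← hb]
  simp
  ring

theorem ne_of_notMem_trace {x : Sph} (hx : x ∉ Γ.trace) (s : ℝ) : Γ.toFun s ≠ x :=
  fun h => hx ⟨s, h⟩

theorem continuous_comp_toFun {σ : Sph → ℝ} (hσ : ContinuousOn σ Γ.trace) :
    Continuous fun s => σ (Γ.toFun s) :=
  hσ.comp_continuous Γ.continuous_toFun fun s => mem_range_self s

theorem isOpen_compl_trace : IsOpen Γ.traceᶜ := Γ.isCompact_trace.isClosed.isOpen_compl

section Layers

variable {σ : Sph → ℝ}

theorem singleLayer_eq (x : Sph) : Γ.singleLayer σ x =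
    ∫ s in (0 : ℝ)..Γ.length, logKernel (x, Γ.pos s, σ (Γ.toFun s)) :=
  intervalIntegral.integral_congr fun s _ => (Sph.logKernel_eq_fundSol x (Γ.toFun s) _).symm

theorem doubleLayer_eq {x : Sph} (hx : x ∉ Γ.trace) : Γ.doubleLayer σ x =
    ∫ s in (0 : ℝ)..Γ.length, dipoleKernel (x, Γ.pos s, Γ.normal s, σ (Γ.toFun s)) :=
  intervalIntegral.integral_congr fun s _ => by
    simp [dipoleKernel, Γ.doubleKernel_eq (Γ.ne_of_notMem_trace hx s)]

theorem mem_kernelDomain {P : Type*} {f : P → E3} {x : Sph} (hx : x ∉ Γ.trace) {s : ℝ} {p : P}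
    (hp : f p = Γ.pos s) : ((x : E3), p) ∈ kernelDomain f := by
  refine ⟨x.ne_zero, ?_⟩
  change (inner ℝ (‖(x : E3)‖⁻¹ • (x : E3)) (f p) : ℝ) ≠ 1
  rw [hp, norm_sph, inv_one, one_smul]
  exact inner_sph_ne_one (Γ.ne_of_notMem_trace hx s).symm

theorem contMDiffOn_singleLayer (hσ : ContinuousOn σ Γ.trace) :
    ContMDiffOn (𝓡 2) 𝓘(ℝ, ℝ) ∞ (Γ.singleLayer σ) Γ.traceᶜ := by
  have ha : Continuous fun s => (Γ.pos s, σ (Γ.toFun s)) :=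
    Γ.continuous_pos.prodMk (Γ.continuous_comp_toFun hσ)
  exact Sph.contMDiffOn_of_eqOn (fun y _ => Γ.singleLayer_eq y)
    (contDiffOn_parametric (L := Γ.length) (isOpen_kernelDomain continuous_fst) ha
      contDiffOn_logKernel) fun y hy s _ => Γ.mem_kernelDomain hy rfl

theorem contMDiffOn_doubleLayer (hσ : ContinuousOn σ Γ.trace) :
    ContMDiffOn (𝓡 2) 𝓘(ℝ, ℝ) ∞ (Γ.doubleLayer σ) Γ.traceᶜ := by
  have ha : Continuous fun s => (Γ.pos s, Γ.normal s, σ (Γ.toFun s)) :=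
    Γ.continuous_pos.prodMk (Γ.continuous_normal.prodMk (Γ.continuous_comp_toFun hσ))
  exact Sph.contMDiffOn_of_eqOn (fun y hy => Γ.doubleLayer_eq hy)
    (contDiffOn_parametric (L := Γ.length) (isOpen_kernelDomain continuous_fst) ha
      contDiffOn_dipoleKernel) fun y hy s _ => Γ.mem_kernelDomain hy rfl

theorem laplaceBeltrami_singleLayer (hσ : ContinuousOn σ Γ.trace) {x : Sph} (hx : x ∉ Γ.trace) :
    Sph.laplaceBeltrami (Γ.singleLayer σ) x = 1 / (4 * Real.pi) * Γ.lineIntegral σ := by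
  have ha : Continuous fun s => (Γ.pos s, σ (Γ.toFun s)) :=
    Γ.continuous_pos.prodMk (Γ.continuous_comp_toFun hσ)
  have he := Sph.radialExt_eventuallyEq isOpen_univ (mem_univ x) (u := Γ.singleLayer σ)
    (H := fun X => ∫ s in (0 : ℝ)..Γ.length, logKernel (X, Γ.pos s, σ (Γ.toFun s)))
    (fun y _ => Γ.singleLayer_eq y)
    (fun Y hY => by simp only [logKernel, norm_inv_smul_smul (inv_pos.2 (norm_pos_iff.2 hY))])
  rw [Sph.laplaceBeltrami, (InnerProductSpace.laplacian_congr_nhds he).self_of_nhds,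
    laplacian_parametric (a := fun s => (Γ.pos s, σ (Γ.toFun s)))
      (isOpen_kernelDomain continuous_fst) ha contDiffOn_logKernel
      (fun s _ => Γ.mem_kernelDomain hx rfl), lineIntegral, ← intervalIntegral.integral_const_mul]
  exact intervalIntegral.integral_congr fun s _ => laplacian_logKernel (norm_sph x) (Γ.norm_pos s) _
    (inner_sph_ne_one (Γ.ne_of_notMem_trace hx s).symm)

theorem laplaceBeltrami_doubleLayer (hσ : ContinuousOn σ Γ.trace) {x : Sph} (hx : x ∉ Γ.trace) :
    Sph.laplaceBeltrami (Γ.doubleLayer σ) x = 0 := by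
  have ha : Continuous fun s => (Γ.pos s, Γ.normal s, σ (Γ.toFun s)) :=
    Γ.continuous_pos.prodMk (Γ.continuous_normal.prodMk (Γ.continuous_comp_toFun hσ))
  have he := Sph.radialExt_eventuallyEq Γ.isOpen_compl_trace hx (u := Γ.doubleLayer σ)
    (H := fun X => ∫ s in (0 : ℝ)..Γ.length,
      dipoleKernel (X, Γ.pos s, Γ.normal s, σ (Γ.toFun s)))
    (fun y hy => Γ.doubleLayer_eq hy)
    (fun Y hY => by simp only [dipoleKernel, norm_inv_smul_smul (inv_pos.2 (norm_pos_iff.2 hY))])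
  rw [Sph.laplaceBeltrami, (InnerProductSpace.laplacian_congr_nhds he).self_of_nhds,
    laplacian_parametric (a := fun s => (Γ.pos s, Γ.normal s, σ (Γ.toFun s)))
      (isOpen_kernelDomain continuous_fst) ha contDiffOn_dipoleKernel
      (fun s _ => Γ.mem_kernelDomain hx rfl)]
  rw [intervalIntegral.integral_congr (g := fun _ => (0 : ℝ)) fun s _ =>
    laplacian_dipoleKernel (norm_sph x) (Γ.norm_pos s) _ (Γ.inner_pos_normal s)
    (inner_sph_ne_one (Γ.ne_of_notMem_trace hx s).symm)]
  simp

end Layers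

end SphCurve

/-! ### Maximum principle and uniqueness -/

/-- The second derivatives are nonpositive at a local maximum. -/
theorem IsLocalMax.iteratedFDeriv_two_diag_nonpos {E : Type*} [NormedAddCommGroup E]
    [NormedSpace ℝ E] {G : E → ℝ} {x : E} (hG : ContDiffAt ℝ 2 G x) (hx : IsLocalMax G x) (v : E) :
    iteratedFDeriv ℝ 2 G x ![v, v] ≤ 0 := by
  by_contra! hpos
  have hev := hG.eventually_hasDerivAt_line v
  have h2 := hG.hasDerivAt_fderiv_line v
  have hderiv : deriv (fun r : ℝ => G (x + r • v)) =ᶠ[𝓝 0]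
      fun r => fderiv ℝ G (x + r • v) v := hev.mono fun r hr => hr.deriv
  have hmax : IsLocalMax (fun r : ℝ => G (x + r • v)) 0 := by
    filter_upwards [(tendsto_line x v).eventually hx] with r hr
    simpa using hr
  -- A positive second derivative would make 0 a local minimum as well, so the function would be
  -- locally constant on the line.
  have hmin := isLocalMin_of_deriv_deriv_pos (f := fun r : ℝ => G (x + r • v)) (x₀ := 0)
    (by rwa [hderiv.deriv_eq, h2.deriv]) hmax.deriv_eq_zero hev.self_of_nhds.continuousAt
  have hconst : (fun r : ℝ => G (x + r • v)) =ᶠ[𝓝 0] fun _ => G (x + (0 : ℝ) • v) := by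
    filter_upwards [hmax, hmin] with r h1 h2
    exact le_antisymm h1 h2
  have h3 : deriv (deriv fun r : ℝ => G (x + r • v)) 0 = 0 := by
    rw [hconst.deriv.deriv_eq]
    simp
  rw [hderiv.deriv_eq, h2.deriv] at h3
  exact hpos.ne' h3

theorem IsLocalMax.laplacian_nonpos {G : E3 → ℝ} {x : E3} (hG : ContDiffAt ℝ 2 G x)
    (hx : IsLocalMax G x) : (Laplacian.laplacian G : E3 → ℝ) x ≤ 0 := by
  rw [InnerProductSpace.laplacian_eq_iteratedFDeriv_stdOrthonormalBasis]
  exact Finset.sum_nonpos fun i _ => hx.iteratedFDeriv_two_diag_nonpos hG _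

namespace SphCurve

variable {Γ : SphCurve} {S₁ S₂ : Set Sph}

namespace Divides

theorem mem_two_or_mem_trace (hΓ : Γ.Divides S₁ S₂) {x : Sph} (hx : x ∉ S₁) :
    x ∈ S₂ ∨ x ∈ Γ.trace := by
  by_cases h : x ∈ Γ.trace
  · exact Or.inr h
  · have : x ∈ S₁ ∪ S₂ := by
      rw [hΓ.union_eq]
      exact h
    exact Or.inl (this.resolve_left hx)

theorem notMem_trace_of_mem_two (hΓ : Γ.Divides S₁ S₂) {x : Sph} (hx : x ∈ S₂) : x ∉ Γ.trace := by
  have : x ∈ S₁ ∪ S₂ := Or.inr hx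
  rwa [hΓ.union_eq] at this

theorem notMem_trace_of_mem_one (hΓ : Γ.Divides S₁ S₂) {x : Sph} (hx : x ∈ S₁) : x ∉ Γ.trace := by
  have : x ∈ S₁ ∪ S₂ := Or.inl hx
  rwa [hΓ.union_eq] at this

theorem nonempty_one (hΓ : Γ.Divides S₁ S₂) : S₁.Nonempty := by
  by_contra h
  have := hΓ.frontier_eq
  rw [not_nonempty_iff_eq_empty.1 h, frontier_empty] at this
  exact this.symm.subset (mem_range_self (0 : ℝ))

/-- The weak maximum principle. -/
theorem nonpos_of_harmonic (hΓ : Γ.Divides S₁ S₂) {u : Sph → ℝ}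
    (hu : Γ.SolvesDirichlet S₂ (fun _ => 0) u) {x : Sph} (hx : x ∈ S₂) : u x ≤ 0 := by
  classical
  by_contra! hpos
  -- A pole in S₁ keeps the barrier continuous on the compact set S₁ᶜ, which consists of S₂ and the
  -- curve.
  obtain ⟨p, hp⟩ := hΓ.nonempty_one
  set h : Sph → ℝ := fun y => logKernel (y, p, 1) with hh
  have hne : ∀ y ∉ S₁, y ≠ p := fun y hy he => hy (he ▸ hp)
  have hcont : ContinuousOn h S₁ᶜ := fun y hy =>
    ((contDiffAt_logKernel 1 (hne y hy)).continuousAt.comp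
      continuous_subtype_val.continuousAt).continuousWithinAt
  have hK : IsCompact S₁ᶜ := hΓ.isOpen_one.isClosed_compl.isCompact
  have hx1 : x ∉ S₁ := fun h1 => hΓ.disjoint.le_bot ⟨h1, hx⟩
  obtain ⟨B, hB⟩ := hK.exists_bound_of_continuousOn hcont
  have hB0 : 0 ≤ B := (norm_nonneg _).trans (hB x hx1)
  -- This makes 2εB < u x, so the perturbation cannot move the maximum onto the curve, where the
  -- extension of u is zero.
  set ε : ℝ := u x / (2 * B + 1) with hε
  have hε0 : 0 < ε := by positivity
  have hεB : 2 * (ε * B) < u x := by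
    have : ε * (2 * B + 1) = u x := by rw [hε]; field_simp
    nlinarith
  -- Zero boundary values make the extension of u by zero continuous up to and along the curve.
  have hindc : ContinuousOn (indicator S₂ u) S₁ᶜ := by
    intro y hy
    rcases hΓ.mem_two_or_mem_trace hy with h2 | hC
    · have hn := hΓ.isOpen_two.mem_nhds h2
      refine ContinuousAt.continuousWithinAt ?_
      refine ((hu.smooth.continuousOn).continuousAt hn).congr ?_
      filter_upwards [hn] with z hz
      rw [indicator_of_mem hz]
    · have hy2 : y ∉ S₂ := fun h2 => hΓ.notMem_trace_of_mem_two h2 hC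
      have ht : Tendsto (indicator S₂ u) (𝓝[S₂] y) (𝓝 0) :=
        (hu.boundary y hC).congr' (eventually_mem_nhdsWithin.mono fun z hz =>
          (indicator_of_mem hz u).symm)
      have ht' : Tendsto (indicator S₂ u) (𝓝[S₂ᶜ] y) (𝓝 0) :=
        tendsto_const_nhds.congr' (eventually_mem_nhdsWithin.mono fun z hz =>
          (indicator_of_notMem hz u).symm)
      have := ht.sup ht'
      rw [← nhdsWithin_union, union_compl_self, nhdsWithin_univ] at this
      rw [ContinuousWithinAt, indicator_of_notMem hy2]
      exact this.mono_left nhdsWithin_le_nhds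
  obtain ⟨z, hz, hmax⟩ := hK.exists_isMaxOn ⟨x, hx1⟩ (hindc.add (hcont.const_smul ε))
  have hmax' : ∀ y ∉ S₁, indicator S₂ u y + ε * h y ≤ indicator S₂ u z + ε * h z :=
    fun y hy => hmax hy
  have hz2 : z ∈ S₂ := by
    by_contra hz2
    have h1 := hmax' x hx1
    rw [indicator_of_mem hx, indicator_of_notMem hz2] at h1
    have h2 := mul_le_mul_of_nonneg_left (abs_le.1 (hB z hz)).2 hε0.le
    have h3 := mul_le_mul_of_nonneg_left (abs_le.1 (hB x hx1)).1 hε0.le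
    linarith
  have hzp := hne z hz
  have hcu : ContDiffAt ℝ 2 (Sph.radialExt u) (z : E3) :=
    (Sph.contDiffAt_radialExt hΓ.isOpen_two hu.smooth hz2).of_le two_le_infty
  have hch : ContDiffAt ℝ 2 (fun X : E3 => logKernel (X, (p : E3), ε)) (z : E3) :=
    (contDiffAt_logKernel ε hzp).of_le two_le_infty
  -- Both summands are constant along rays, so a maximum on the sphere is a local maximum in space.
  have hloc : IsLocalMax (Sph.radialExt u + fun X : E3 => logKernel (X, (p : E3), ε)) (z : E3) := by
    filter_upwards [Sph.eventually_proj_mem hΓ.isOpen_two hz2] with Y ⟨hY, hY2⟩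
    have hY1 : (⟨‖Y‖⁻¹ • Y, norm_inv_smul_mem_sphere hY⟩ : Sph) ∉ S₁ :=
      fun h1 => hΓ.disjoint.le_bot ⟨h1, hY2⟩
    have := hmax' _ hY1
    rw [indicator_of_mem hY2, indicator_of_mem hz2] at this
    simp only [Pi.add_apply, Sph.radialExt_coe, Sph.radialExt_of_ne hY]
    simp only [hh, logKernel, norm_inv_smul_smul (inv_pos.2 (norm_pos_iff.2 hY)), mul_one] at this ⊢
    linarith
  have hlap : (Laplacian.laplacian (Sph.radialExt u + fun X : E3 => logKernel (X, (p : E3), ε)) :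
      E3 → ℝ) (z : E3) ≤ 0 := hloc.laplacian_nonpos (hcu.add hch)
  rw [hcu.laplacian_add hch, laplacian_logKernel (norm_sph z) (norm_sph p) ε
    (inner_sph_ne_one hzp)] at hlap
  have h0 : (Laplacian.laplacian (Sph.radialExt u) : E3 → ℝ) (z : E3) = 0 := hu.harmonic z hz2
  rw [h0, zero_add] at hlap
  have : 0 < 1 / (4 * Real.pi) * ε := by positivity
  linarith

theorem solvesDirichlet_sub (hΓ : Γ.Divides S₁ S₂) {g u v : Sph → ℝ}
    (hu : Γ.SolvesDirichlet S₂ g u) (hv : Γ.SolvesDirichlet S₂ g v) :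
    Γ.SolvesDirichlet S₂ (fun _ => 0) (u - v) where
  smooth := hu.smooth.sub hv.smooth
  harmonic x hx := by
    have hcu := (Sph.contDiffAt_radialExt hΓ.isOpen_two hu.smooth hx).of_le two_le_infty
    have hcv := (Sph.contDiffAt_radialExt hΓ.isOpen_two hv.smooth hx).of_le two_le_infty
    have he : Sph.radialExt (u - v) = Sph.radialExt u - Sph.radialExt v := by
      ext Y
      by_cases hY : Y = 0
      · simp [Sph.radialExt, hY]
      · simp [Sph.radialExt, hY]
    rw [Sph.laplaceBeltrami, he, hcu.laplacian_sub hcv]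
    have h1 := hu.harmonic x hx
    have h2 := hv.harmonic x hx
    rw [Sph.laplaceBeltrami] at h1 h2
    rw [h1, h2, sub_zero]
  boundary x₀ hx₀ := by
    have h := (hu.boundary x₀ hx₀).sub (hv.boundary x₀ hx₀)
    rwa [sub_self] at h

/-- The Dirichlet problem has at most one solution. -/
theorem solvesDirichlet_unique (hΓ : Γ.Divides S₁ S₂) {g u v : Sph → ℝ}
    (hu : Γ.SolvesDirichlet S₂ g u) (hv : Γ.SolvesDirichlet S₂ g v) : EqOn u v S₂ := fun x hx => by
  have h1 := hΓ.nonpos_of_harmonic (hΓ.solvesDirichlet_sub hu hv) hx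
  have h2 := hΓ.nonpos_of_harmonic (hΓ.solvesDirichlet_sub hv hu) hx
  simp only [Pi.sub_apply] at h1 h2
  linarith

end Divides

end SphCurve

/-! ### Tubular neighbourhood and the side of S₂ -/

namespace SphCurve

noncomputable section

variable (Γ : SphCurve)

theorem norm_tube (s δ : ℝ) : ‖Real.cos δ • Γ.pos s + Real.sin δ • Γ.normal s‖ = 1 := by
  have h : ‖Real.cos δ • Γ.pos s + Real.sin δ • Γ.normal s‖ ^ 2 = 1 := by
    rw [norm_add_sq_real, norm_smul, norm_smul, real_inner_smul_left, real_inner_smul_right,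
      inner_pos_normal, norm_pos, norm_normal]
    simp
  nlinarith [norm_nonneg (Real.cos δ • Γ.pos s + Real.sin δ • Γ.normal s)]

/-- Geodesic normal coordinates along the curve. -/
def tube (q : ℝ × ℝ) : Sph :=
  ⟨Real.cos q.2 • Γ.pos q.1 + Real.sin q.2 • Γ.normal q.1, by
    rw [mem_sphere_zero_iff_norm]
    exact Γ.norm_tube _ _⟩

theorem continuous_tube : Continuous Γ.tube := by
  refine continuous_induced_rng.2 ?_
  have h1 : Continuous fun q : ℝ × ℝ => Γ.pos q.1 := Γ.continuous_pos.comp continuous_fst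
  have h2 : Continuous fun q : ℝ × ℝ => Γ.normal q.1 := Γ.continuous_normal.comp continuous_fst
  exact ((Real.continuous_cos.comp continuous_snd).smul h1).add
    ((Real.continuous_sin.comp continuous_snd).smul h2)

theorem tube_zero (s : ℝ) : Γ.tube (s, 0) = Γ.toFun s := Subtype.ext (by simp [tube, pos])

/-- The curve has a tubular neighbourhood that it meets only in the central line. -/
theorem exists_tube_notMem_trace :
    ∃ b : ℝ, 0 < b ∧ ∀ s δ, 0 < |δ| → |δ| < b → Γ.tube (s, δ) ∉ Γ.trace := by
  have hM := Γ.taylorConst_pos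
  have hc := Γ.chordConst_pos
  -- A point at height δ on the curve would give |δ|/2 ≤ |sin δ| ≤ M(r-s)² ≤ Mδ²/c², that is |δ| ≥
  -- c²/(2M). The bound 1 < π/2 justifies the sine estimate.
  refine ⟨min 1 (Γ.chordConst ^ 2 / (2 * Γ.taylorConst)), by positivity, ?_⟩
  rintro s δ h0 hb ⟨s', hs'⟩
  set x := Γ.tube (s, δ) with hx
  have hxE : (x : E3) = Real.cos δ • Γ.pos s + Real.sin δ • Γ.normal s := rfl
  set r := Γ.foot s x with hr
  -- A point of the curve is its own foot; this replaces s' by a parameter within half a period of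
  -- s, where the chord bound applies.
  have hrx : Γ.pos r = x := by
    have h1 := Γ.norm_sub_foot_le s x s'
    have h2 : Γ.pos s' = x := congrArg Subtype.val hs'
    rw [h2, sub_self, norm_zero] at h1
    exact (sub_eq_zero.1 (norm_le_zero_iff.1 h1)).symm
  have hsr : Γ.pos (s + (r - s)) = x := by rw [add_sub_cancel, hrx]
  have hchord := Γ.chord_le (s := s) (Γ.abs_foot_sub_le s x)
  rw [← hr, hsr] at hchord
  have hdist : ‖(x : E3) - Γ.pos s‖ ^ 2 ≤ δ ^ 2 := by
    have h1 := one_sub_inner_eq (norm_sph x) (Γ.norm_pos s)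
    have h2 : (inner ℝ (x : E3) (Γ.pos s) : ℝ) = Real.cos δ := by
      rw [hxE, inner_add_left, real_inner_smul_left, real_inner_smul_left,
        real_inner_self_eq_norm_sq, norm_pos, real_inner_comm, inner_pos_normal]
      simp
    rw [h2] at h1
    have := Real.one_sub_sq_div_two_le_cos (x := δ)
    linarith
  have hsin : (inner ℝ (x : E3) (Γ.normal s) : ℝ) = Real.sin δ := by
    rw [hxE, inner_add_left, real_inner_smul_left, real_inner_smul_left,
      real_inner_self_eq_norm_sq, norm_normal, inner_pos_normal]
    simp
  have hn := Γ.abs_inner_pos_add_normal_le s (r - s)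
  rw [hsr, hsin] at hn
  have hd1 : |δ| < 1 := hb.trans_le (min_le_left _ _)
  have hd2 : |δ| < Γ.chordConst ^ 2 / (2 * Γ.taylorConst) := hb.trans_le (min_le_right _ _)
  have hs := Real.mul_abs_le_abs_sin (x := δ) (by linarith [Real.pi_gt_three])
  have hpi : 1 / 2 ≤ 2 / Real.pi := by
    rw [div_le_div_iff₀ (by norm_num) Real.pi_pos]
    linarith [Real.pi_le_four]
  have h3 : 1 / 2 * |δ| ≤ Γ.taylorConst * (r - s) ^ 2 :=
    (mul_le_mul_of_nonneg_right hpi h0.le).trans (hs.trans hn)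
  have h4 : Γ.chordConst ^ 2 * (r - s) ^ 2 ≤ |δ| ^ 2 := by
    have := pow_le_pow_left₀ (by positivity) hchord 2
    rw [mul_pow, sq_abs] at this
    rw [sq_abs]
    linarith
  rw [lt_div_iff₀ (by positivity)] at hd2
  have h5 : Γ.chordConst ^ 2 * (1 / 2 * |δ|) ≤ Γ.taylorConst * |δ| ^ 2 := by
    calc _ ≤ Γ.chordConst ^ 2 * (Γ.taylorConst * (r - s) ^ 2) := by gcongr
      _ = Γ.taylorConst * (Γ.chordConst ^ 2 * (r - s) ^ 2) := by ring
      _ ≤ _ := by gcongr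
  nlinarith

/-- Near the curve the component β along the foot is positive, so β = √(1 - η²) = cos(arcsin η). -/
theorem eventually_eq_tube_foot (s₀ : ℝ) : ∀ᶠ x in 𝓝 (Γ.toFun s₀),
    x = Γ.tube (Γ.foot s₀ x, Real.arcsin (inner ℝ (x : E3) (Γ.normal (Γ.foot s₀ x)))) := by
  filter_upwards [(Γ.tendsto_inner_pos_foot s₀).eventually (lt_mem_nhds zero_lt_one)] with x hβ
  refine Subtype.ext ?_
  have h1 := Γ.sq_add_sq_foot s₀ x
  change (x : E3) = Real.cos (Real.arcsin _) • _ + Real.sin (Real.arcsin _) • _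
  have h2 : (inner ℝ (x : E3) (Γ.normal (Γ.foot s₀ x)) : ℝ) ^ 2 ≤ 1 := by nlinarith
  have h3 := abs_le.1 ((sq_le_one_iff_abs_le_one _).1 h2)
  rw [Real.cos_arcsin, Real.sin_arcsin h3.1 h3.2, ← eq_sub_of_add_eq h1, Real.sqrt_sq hβ.le]
  exact Γ.eq_foot_frame s₀ x

theorem isPreconnected_tube_image {I : Set ℝ} (hI : IsPreconnected I) :
    IsPreconnected (Γ.tube '' (univ ×ˢ I)) :=
  (isPreconnected_univ.prod hI).image _ Γ.continuous_tube.continuousOn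

variable {Γ} {S₁ S₂ : Set Sph}

/-- The part of the sphere that lies locally to the left of the curve is `S₂`. -/
theorem Divides.eventually_inner_normal_foot_pos (hΓ : Γ.Divides S₁ S₂) (s₀ : ℝ) :
    ∀ᶠ x : Sph in 𝓝[S₂] (Γ.toFun s₀), 0 < (inner ℝ (x : E3) (Γ.normal (Γ.foot s₀ x)) : ℝ) := by
  obtain ⟨b, hb, htr⟩ := Γ.exists_tube_notMem_trace
  have hsub : ∀ I : Set ℝ, (∀ δ ∈ I, 0 < |δ| ∧ |δ| < b) → Γ.tube '' (univ ×ˢ I) ⊆ S₁ ∪ S₂ := by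
    rintro I hI _ ⟨⟨s, δ⟩, ⟨-, hδ⟩, rfl⟩
    rw [hΓ.union_eq]
    exact htr s δ (hI δ hδ).1 (hI δ hδ).2
  have hpos := hsub (Ioo 0 b) fun δ hδ => by
    rw [abs_of_pos hδ.1]
    exact hδ
  have hneg := hsub (Ioo (-b) 0) fun δ hδ => by
    rw [abs_of_neg hδ.2]
    exact ⟨by linarith [hδ.2], by linarith [hδ.1]⟩
  -- The left strip is connected and misses the curve, so the orientation at the single parameter s₀
  -- decides its side.
  have hleft : Γ.tube '' (univ ×ˢ Ioo 0 b) ⊆ S₂ := by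
    refine (Γ.isPreconnected_tube_image isPreconnected_Ioo).subset_right_of_subset_union
      hΓ.isOpen_one hΓ.isOpen_two hΓ.disjoint hpos ?_
    obtain ⟨δ, ⟨y, hy, hyδ⟩, hδ⟩ := ((hΓ.oriented s₀).and (Ioo_mem_nhdsGT hb)).exists
    have : y = Γ.tube (s₀, δ) := Subtype.ext hyδ
    exact ⟨Γ.tube (s₀, δ), mem_image_of_mem _ ⟨mem_univ _, hδ⟩, this ▸ hy⟩
  have harc : Tendsto (fun x : Sph => Real.arcsin (inner ℝ (x : E3) (Γ.normal (Γ.foot s₀ x))))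
      (𝓝 (Γ.toFun s₀)) (𝓝 0) := by
    have := (Real.continuous_arcsin.tendsto 0).comp (Γ.tendsto_inner_normal_foot s₀)
    rwa [Real.arcsin_zero] at this
  have hsmall := harc.eventually (Ioo_mem_nhds (neg_lt_zero.2 hb) hb)
  -- If the right strip lay in S₂ as well, points near the curve could not be in S₁, yet the curve
  -- is the frontier of S₁.
  have hright : Γ.tube '' (univ ×ˢ Ioo (-b) 0) ⊆ S₁ := by
    rcases (Γ.isPreconnected_tube_image isPreconnected_Ioo).subset_or_subset
      hΓ.isOpen_one hΓ.isOpen_two hΓ.disjoint hneg with h | h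
    · exact h
    · exfalso
      have hfr : Γ.toFun s₀ ∈ frontier S₁ := by
        rw [hΓ.frontier_eq]
        exact mem_range_self s₀
      obtain ⟨x, hx1, hx2, hx3⟩ := ((mem_closure_iff_frequently.1
        (frontier_subset_closure hfr)).and_eventually
          ((Γ.eventually_eq_tube_foot s₀).and hsmall)).exists
      rcases lt_trichotomy (Real.arcsin (inner ℝ (x : E3) (Γ.normal (Γ.foot s₀ x)))) 0
        with hlt | heq | hgt
      · exact hΓ.disjoint.le_bot
          ⟨hx1, h (hx2 ▸ mem_image_of_mem Γ.tube ⟨mem_univ _, hx3.1, hlt⟩)⟩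
      · rw [heq, tube_zero] at hx2
        exact hΓ.notMem_trace_of_mem_one hx1 (hx2 ▸ mem_range_self _)
      · exact hΓ.disjoint.le_bot
          ⟨hx1, hleft (hx2 ▸ mem_image_of_mem Γ.tube ⟨mem_univ _, hgt, hx3.2⟩)⟩
  filter_upwards [nhdsWithin_le_nhds (Γ.eventually_eq_tube_foot s₀), nhdsWithin_le_nhds hsmall,
    self_mem_nhdsWithin] with x hx hxs hx2
  by_contra! hle
  rcases hle.lt_or_eq with hlt | heq
  · exact hΓ.disjoint.le_bot ⟨hright (hx ▸ mem_image_of_mem Γ.tube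
      ⟨mem_univ _, hxs.1, Real.arcsin_lt_zero.2 hlt⟩), hx2⟩
  · rw [heq, Real.arcsin_zero, tube_zero] at hx
    exact hΓ.notMem_trace_of_mem_two hx2 (hx ▸ mem_range_self _)

end

end SphCurve

theorem ae_ne_zero_real : ∀ᵐ h : ℝ, h ≠ 0 :=
  MeasureTheory.compl_mem_ae_iff.2 (by simp : MeasureTheory.volume ({0} : Set ℝ) = 0)

/-! ### Continuity of the single layer -/

namespace SphCurve

variable (Γ : SphCurve)

/-- Centres the period at a foot point, so that all kernel estimates live on |h| ≤ length/2. -/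
theorem integral_eq_shift {f : ℝ → ℝ} (hf : Function.Periodic f Γ.length) (r : ℝ) :
    ∫ s in (0 : ℝ)..Γ.length, f s = ∫ h in (-(Γ.length / 2))..(Γ.length / 2), f (r + h) := by
  rw [intervalIntegral.integral_comp_add_left]
  have := hf.intervalIntegral_add_eq 0 (r + -(Γ.length / 2))
  rw [zero_add] at this
  rw [this]
  congr 1
  ring

theorem abs_le_of_mem_uIoc {L h : ℝ} (hL : 0 < L) (hh : h ∈ uIoc (-(L / 2)) (L / 2)) :
    |h| ≤ L / 2 := by
  rw [uIoc_of_le (by linarith)] at hh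
  exact abs_le.2 ⟨hh.1.le, hh.2⟩

theorem exists_density_bound {σ : Sph → ℝ} (hσ : ContinuousOn σ Γ.trace) :
    ∃ B : ℝ, 0 ≤ B ∧ ∀ s, |σ (Γ.toFun s)| ≤ B := by
  obtain ⟨B, hB⟩ := Γ.isCompact_trace.exists_bound_of_continuousOn hσ
  exact ⟨B, (norm_nonneg _).trans (hB _ (mem_range_self 0)), fun s => hB _ (mem_range_self s)⟩

theorem one_sub_inner_pos_ne_zero {s h : ℝ} (h0 : h ≠ 0) (hh : |h| ≤ Γ.length / 2) :
    1 - (inner ℝ (Γ.pos s) (Γ.pos (s + h)) : ℝ) ≠ 0 :=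
  sub_ne_zero.2 (inner_sph_ne_one
    (Γ.toFun_add_ne h0 (hh.trans_lt (by linarith [Γ.length_pos]))).symm).symm

theorem tendsto_inner_pos_foot_add (s₀ h : ℝ) :
    Tendsto (fun x : Sph => 1 - (inner ℝ (x : E3) (Γ.pos (Γ.foot s₀ x + h)) : ℝ))
      (𝓝 (Γ.toFun s₀)) (𝓝 (1 - inner ℝ (Γ.pos s₀) (Γ.pos (s₀ + h)))) := by
  have h1 : Tendsto (fun x : Sph => (x : E3)) (𝓝 (Γ.toFun s₀)) (𝓝 (Γ.pos s₀)) :=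
    continuous_subtype_val.tendsto _
  exact (h1.inner (𝕜 := ℝ)
    ((Γ.continuous_pos.tendsto _).comp ((Γ.tendsto_foot s₀).add_const h))).const_sub 1

theorem abs_log_le {a q : ℝ} (ha : 0 < a) (haq : a ≤ q) (hq : q ≤ 2) :
    |Real.log q| ≤ |Real.log a| + Real.log 2 := by
  have h1 := Real.log_le_log ha haq
  have h2 := Real.log_le_log (ha.trans_le haq) hq
  have h3 := neg_abs_le (Real.log a)
  have h4 := Real.log_nonneg one_le_two
  have h5 := abs_nonneg (Real.log a)
  exact abs_le.2 ⟨by linarith, by linarith⟩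

/-- The single layer potential is continuous on the curve. -/
theorem continuousAt_singleLayer {σ : Sph → ℝ} (hσ : ContinuousOn σ Γ.trace) (s₀ : ℝ) :
    ContinuousAt (Γ.singleLayer σ) (Γ.toFun s₀) := by
  obtain ⟨B, hB0, hB⟩ := Γ.exists_density_bound hσ
  have hL := Γ.length_pos
  have hc := Γ.chordConst_pos
  have hσc := Γ.continuous_comp_toFun hσ
  have hform : ∀ (x : Sph) (r : ℝ), Γ.singleLayer σ x =
      ∫ h in (-(Γ.length / 2))..(Γ.length / 2),
        (-(1 / (4 * Real.pi)) * Real.log (1 - inner ℝ (x : E3) (Γ.pos (r + h)))) *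
          σ (Γ.toFun (r + h)) := by
    intro x r
    rw [Γ.singleLayer_eq x]
    simp only [logKernel, norm_sph, inv_one, one_smul]
    exact Γ.integral_eq_shift (f := fun s =>
      (-(1 / (4 * Real.pi)) * Real.log (1 - inner ℝ (x : E3) (Γ.pos s))) * σ (Γ.toFun s))
      (fun s => by simp only [Γ.periodic_pos s, Γ.periodic s]) r
  rw [ContinuousAt, hform (Γ.toFun s₀) s₀]
  -- Recentring at the foot of x keeps the near-singularity at h = 0, so one majorant serves all x.
  -- It comes from (c²/8)h² ≤ 1 - ⟨x, p(r+h)⟩ ≤ 2.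
  refine Tendsto.congr (fun x => (hform x (Γ.foot s₀ x)).symm) ?_
  refine intervalIntegral.tendsto_integral_filter_of_dominated_convergence
    (fun h => 1 / (4 * Real.pi) *
      (|Real.log (Γ.chordConst ^ 2 / 8)| + 2 * |Real.log h| + Real.log 2) * B) ?_ ?_ ?_ ?_
  · refine Eventually.of_forall fun x => Measurable.aestronglyMeasurable ?_
    have h1 : Continuous fun h => 1 - (inner ℝ (x : E3) (Γ.pos (Γ.foot s₀ x + h)) : ℝ) :=
      continuous_const.sub (continuous_const.inner (Γ.continuous_pos.comp (by fun_prop)))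
    have h2 : Continuous fun h => σ (Γ.toFun (Γ.foot s₀ x + h)) := hσc.comp (by fun_prop)
    exact ((Real.measurable_log.comp h1.measurable).const_mul _).mul h2.measurable
  · refine Eventually.of_forall fun x => ?_
    filter_upwards [ae_ne_zero_real] with h h0 hh
    have hh' := abs_le_of_mem_uIoc hL hh
    have hq := Γ.sq_le_one_sub_inner (s₀ := s₀) x hh'
    have hq2 : 1 - (inner ℝ (x : E3) (Γ.pos (Γ.foot s₀ x + h)) : ℝ) ≤ 2 := by
      have := (abs_le.1 (abs_real_inner_le_norm (x : E3) (Γ.pos (Γ.foot s₀ x + h)))).1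
      rw [norm_sph, norm_pos] at this
      linarith
    have hlog := abs_log_le (by positivity) hq hq2
    rw [Real.log_mul (by positivity) (by positivity), Real.log_pow] at hlog
    have h3 := abs_add_le (Real.log (Γ.chordConst ^ 2 / 8)) ((2 : ℕ) * Real.log h)
    rw [abs_mul, Nat.abs_cast] at h3
    push_cast at h3 hlog
    rw [norm_mul, norm_mul, norm_neg, Real.norm_of_nonneg (by positivity : 0 ≤ 1 / (4 * Real.pi)),
      Real.norm_eq_abs, Real.norm_eq_abs]
    have := hB (Γ.foot s₀ x + h)
    gcongr
    linarith
  · have hlog : IntervalIntegrable Real.log MeasureTheory.volume (-(Γ.length / 2))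
      (Γ.length / 2) := intervalIntegral.intervalIntegrable_log'
    exact (((intervalIntegrable_const.add (hlog.abs.const_mul 2)).add
      intervalIntegrable_const).const_mul _).mul_const B
  · filter_upwards [ae_ne_zero_real] with h h0 hh
    have hq := Γ.one_sub_inner_pos_ne_zero (s := s₀) h0 (abs_le_of_mem_uIoc hL hh)
    refine (((Γ.tendsto_inner_pos_foot_add s₀ h).log hq).const_mul _).mul ?_
    exact (hσc.tendsto _).comp ((Γ.tendsto_foot s₀).add_const h)

/-! ### The regular part and the principal value -/

section Jump

variable {μ : Sph → ℝ}

/-- The regular part of the double layer kernel at the foot point `r` of `x`. -/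
noncomputable def regularKernel (x : E3) (r h : ℝ) : ℝ :=
  inner ℝ (Γ.pos r) (Γ.normal (r + h)) / (1 - inner ℝ x (Γ.pos (r + h)))

theorem measurable_kernel (v x : E3) (r : ℝ) : Measurable fun h =>
    (inner ℝ v (Γ.normal (r + h)) : ℝ) / (1 - inner ℝ x (Γ.pos (r + h))) := by
  have h1 : Continuous fun h => (inner ℝ v (Γ.normal (r + h)) : ℝ) :=
    continuous_const.inner (Γ.continuous_normal.comp (by fun_prop))
  have h2 : Continuous fun h => 1 - (inner ℝ x (Γ.pos (r + h)) : ℝ) :=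
    continuous_const.sub (continuous_const.inner (Γ.continuous_pos.comp (by fun_prop)))
  exact h1.measurable.div h2.measurable

/-- The numerator is at most M h² and the denominator at least (c²/8)h², uniformly in x. -/
theorem abs_regularKernel_le {s₀ : ℝ} (x : Sph) {h : ℝ} (hh : |h| ≤ Γ.length / 2) :
    |Γ.regularKernel x (Γ.foot s₀ x) h| ≤ 8 * Γ.taylorConst / Γ.chordConst ^ 2 := by
  have hc := Γ.chordConst_pos
  have hM := Γ.taylorConst_pos
  have hq := Γ.sq_le_one_sub_inner (s₀ := s₀) x hh
  have hq0 : 0 ≤ 1 - (inner ℝ (x : E3) (Γ.pos (Γ.foot s₀ x + h)) : ℝ) := le_trans (by positivity) hq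
  rw [regularKernel, abs_div, abs_of_nonneg hq0]
  refine div_le_of_le_mul₀ hq0 (by positivity)
    ((Γ.abs_inner_pos_normal_add_le (Γ.foot s₀ x) h).trans ?_)
  calc Γ.taylorConst * h ^ 2 = 8 * Γ.taylorConst / Γ.chordConst ^ 2 *
      (Γ.chordConst ^ 2 / 8 * h ^ 2) := by field_simp
    _ ≤ _ := by gcongr

theorem foot_self (s₀ : ℝ) : Γ.foot s₀ (Γ.toFun s₀) = s₀ := by
  have h1 := Γ.chord_le (s := s₀) (Γ.abs_foot_sub_le s₀ (Γ.toFun s₀))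
  have h2 := Γ.norm_sub_foot_le s₀ (Γ.toFun s₀) s₀
  change ‖Γ.pos s₀ - Γ.pos _‖ ≤ ‖Γ.pos s₀ - Γ.pos s₀‖ at h2
  rw [sub_self, norm_zero, norm_sub_rev] at h2
  rw [add_sub_cancel] at h1
  have h3 : |Γ.foot s₀ (Γ.toFun s₀) - s₀| ≤ 0 := by
    have := Γ.chordConst_pos
    by_contra! hcon
    have := mul_pos this hcon
    linarith
  linarith [abs_nonpos_iff.1 h3]

theorem tendsto_regular_part (hμ : ContinuousOn μ Γ.trace) (s₀ : ℝ) :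
    Tendsto (fun x : Sph => ∫ h in (-(Γ.length / 2))..(Γ.length / 2),
        μ (Γ.toFun (Γ.foot s₀ x + h)) * Γ.regularKernel x (Γ.foot s₀ x) h) (𝓝 (Γ.toFun s₀))
      (𝓝 (∫ h in (-(Γ.length / 2))..(Γ.length / 2),
        μ (Γ.toFun (s₀ + h)) * Γ.regularKernel (Γ.pos s₀) s₀ h)) := by
  obtain ⟨B, hB0, hB⟩ := Γ.exists_density_bound hμ
  have hL := Γ.length_pos
  have hμc := Γ.continuous_comp_toFun hμ
  refine intervalIntegral.tendsto_integral_filter_of_dominated_convergence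
    (fun _ => B * (8 * Γ.taylorConst / Γ.chordConst ^ 2)) ?_ ?_ intervalIntegrable_const ?_
  · refine Eventually.of_forall fun x => Measurable.aestronglyMeasurable ?_
    have h2 : Continuous fun h => μ (Γ.toFun (Γ.foot s₀ x + h)) := hμc.comp (by fun_prop)
    exact h2.measurable.mul (Γ.measurable_kernel _ _ _)
  · refine Eventually.of_forall fun x => Eventually.of_forall fun h hh => ?_
    rw [norm_mul]
    exact mul_le_mul (hB _) (Γ.abs_regularKernel_le x (abs_le_of_mem_uIoc hL hh))
      (norm_nonneg _) hB0
  · filter_upwards [ae_ne_zero_real] with h h0 hh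
    have hf := (Γ.tendsto_foot s₀).add_const h
    exact ((hμc.tendsto _).comp hf).mul ((((Γ.continuous_pos.tendsto _).comp
      (Γ.tendsto_foot s₀)).inner (𝕜 := ℝ) ((Γ.continuous_normal.tendsto _).comp hf)).div
        (Γ.tendsto_inner_pos_foot_add s₀ h)
        (Γ.one_sub_inner_pos_ne_zero h0 (abs_le_of_mem_uIoc hL hh)))

/-- The truncation keeps the integration point away from the pole, where the kernel formula holds;
for x₀ on the curve it is the regular kernel alone. -/
theorem opKTrunc_eq (s₀ : ℝ) {ε : ℝ} (hε : 0 < ε) : Γ.opKTrunc μ (Γ.toFun s₀) ε =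
    ∫ h in (-(Γ.length / 2))..(Γ.length / 2),
      {h | ε ≤ dist (Γ.toFun (s₀ + h)) (Γ.toFun s₀)}.indicator
        (fun h => 1 / (4 * Real.pi) *
          (μ (Γ.toFun (s₀ + h)) * Γ.regularKernel (Γ.pos s₀) s₀ h)) h := by
  classical
  have hdk : ∀ s, ε ≤ dist (Γ.toFun s) (Γ.toFun s₀) → Γ.doubleKernel (Γ.toFun s₀) s =
      1 / (4 * Real.pi) * (inner ℝ (Γ.pos s₀) (Γ.normal s) / (1 - inner ℝ (Γ.pos s₀) (Γ.pos s))) :=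
    fun s hs => Γ.doubleKernel_eq (dist_pos.1 (hε.trans_le hs))
  have hfun : Γ.opKTrunc μ (Γ.toFun s₀) ε = ∫ s in (0 : ℝ)..Γ.length,
      if ε ≤ dist (Γ.toFun s) (Γ.toFun s₀) then 1 / (4 * Real.pi) * (μ (Γ.toFun s) *
        (inner ℝ (Γ.pos s₀) (Γ.normal s) / (1 - inner ℝ (Γ.pos s₀) (Γ.pos s)))) else 0 := by
    rw [opKTrunc]
    refine intervalIntegral.integral_congr fun s _ => ?_
    by_cases h : ε ≤ dist (Γ.toFun s) (Γ.toFun s₀)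
    · simp only [if_pos h, hdk s h]
      ring
    · simp only [if_neg h]
  rw [hfun, Γ.integral_eq_shift (fun s => by
    simp only [Γ.periodic s, Γ.periodic_normal s, Γ.periodic_pos s]) s₀]
  refine intervalIntegral.integral_congr fun h _ => ?_
  simp only [indicator_apply, mem_ofPred_eq, regularKernel]

/-- The principal value of the double layer operator. -/
theorem opK_eq (hμ : ContinuousOn μ Γ.trace) (s₀ : ℝ) : Γ.opK μ (Γ.toFun s₀) =
    1 / (4 * Real.pi) * ∫ h in (-(Γ.length / 2))..(Γ.length / 2),
      μ (Γ.toFun (s₀ + h)) * Γ.regularKernel (Γ.pos s₀) s₀ h := by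
  obtain ⟨B, hB0, hB⟩ := Γ.exists_density_bound hμ
  have hL := Γ.length_pos
  have hμc := Γ.continuous_comp_toFun hμ
  rw [← intervalIntegral.integral_const_mul]
  refine Tendsto.limUnder_eq ?_
  refine Tendsto.congr' (eventually_mem_nhdsWithin.mono fun ε hε => (Γ.opKTrunc_eq s₀ hε).symm) ?_
  have hreg : ∀ h, |h| ≤ Γ.length / 2 →
      |Γ.regularKernel (Γ.pos s₀) s₀ h| ≤ 8 * Γ.taylorConst / Γ.chordConst ^ 2 := fun h hh => by
    have := Γ.abs_regularKernel_le (s₀ := s₀) (Γ.toFun s₀) hh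
    rwa [foot_self] at this
  -- The kernel is bounded on the curve and the truncated sets exhaust all h ≠ 0, so the principal
  -- value is an ordinary integral.
  refine intervalIntegral.tendsto_integral_filter_of_dominated_convergence
    (fun _ => 1 / (4 * Real.pi) * (B * (8 * Γ.taylorConst / Γ.chordConst ^ 2)))
    ?_ ?_ intervalIntegrable_const ?_
  · refine Eventually.of_forall fun ε => Measurable.aestronglyMeasurable ?_
    have h2 : Continuous fun h => μ (Γ.toFun (s₀ + h)) := hμc.comp (by fun_prop)
    have h3 : Continuous fun h => dist (Γ.toFun (s₀ + h)) (Γ.toFun s₀) :=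
      (Γ.continuous_toFun.comp (by fun_prop)).dist continuous_const
    exact ((h2.measurable.mul (Γ.measurable_kernel _ _ _)).const_mul _).indicator
      (isClosed_le continuous_const h3).measurableSet
  · refine Eventually.of_forall fun ε => Eventually.of_forall fun h hh => ?_
    refine (norm_indicator_le_norm_self _ _).trans ?_
    rw [norm_mul, norm_mul, Real.norm_of_nonneg (by positivity : 0 ≤ 1 / (4 * Real.pi))]
    exact mul_le_mul_of_nonneg_left (mul_le_mul (hB _) (hreg h (abs_le_of_mem_uIoc hL hh))
      (norm_nonneg _) hB0) (by positivity)
  · filter_upwards [ae_ne_zero_real] with h h0 hh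
    refine tendsto_const_nhds.congr' ?_
    have hne := Γ.toFun_add_ne (s := s₀) h0 ((abs_le_of_mem_uIoc hL hh).trans_lt (by linarith))
    filter_upwards [nhdsWithin_le_nhds (gt_mem_nhds (dist_pos.2 hne))] with ε hε
    rw [indicator_of_mem]
    exact hε.le

end Jump

end SphCurve

/-! ### The singular part and the jump relation -/

namespace SphCurve

variable (Γ : SphCurve)

/-- The signed height of `x` over the curve, measured at the foot point. -/
noncomputable def height (s₀ : ℝ) (x : Sph) : ℝ := inner ℝ (x : E3) (Γ.normal (Γ.foot s₀ x))

theorem tendsto_height (s₀ : ℝ) : Tendsto (Γ.height s₀) (𝓝 (Γ.toFun s₀)) (𝓝 0) :=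
  Γ.tendsto_inner_normal_foot s₀

/-- The denominator of the kernels is bounded below by the squared distance to `x`. -/
theorem exists_sq_add_sq_le_one_sub_inner : ∃ k : ℝ, 0 < k ∧ ∀ (s₀ : ℝ) (x : Sph) (h : ℝ),
    |h| ≤ Γ.length / 2 →
      k * (h ^ 2 + Γ.height s₀ x ^ 2) ≤ 1 - inner ℝ (x : E3) (Γ.pos (Γ.foot s₀ x + h)) := by
  have hc := Γ.chordConst_pos
  -- The average of two lower bounds for the denominator, (c²/8)h² and η²/2; the latter follows from
  -- η² = 1 - β² ≤ 2(1 - β).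
  refine ⟨min (Γ.chordConst ^ 2 / 16) (1 / 4), by positivity, fun s₀ x h hh => ?_⟩
  have h1 := Γ.sq_le_one_sub_inner (s₀ := s₀) x hh
  have h2 := Γ.inner_le_inner_foot s₀ x (Γ.foot s₀ x + h)
  have h3 := Γ.sq_add_sq_foot s₀ x
  change _ + Γ.height s₀ x ^ 2 = 1 at h3
  have h4 : (inner ℝ (x : E3) (Γ.pos (Γ.foot s₀ x)) : ℝ) ≤ 1 := by
    nlinarith [sq_nonneg (Γ.height s₀ x)]
  have h5 : Γ.height s₀ x ^ 2 ≤ 2 * (1 - inner ℝ (x : E3) (Γ.pos (Γ.foot s₀ x))) := by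
    nlinarith [sq_nonneg (1 - (inner ℝ (x : E3) (Γ.pos (Γ.foot s₀ x)) : ℝ))]
  have h6 : min (Γ.chordConst ^ 2 / 16) (1 / 4) * h ^ 2 ≤ Γ.chordConst ^ 2 / 16 * h ^ 2 :=
    mul_le_mul_of_nonneg_right (min_le_left _ _) (sq_nonneg h)
  have h7 : min (Γ.chordConst ^ 2 / 16) (1 / 4) * Γ.height s₀ x ^ 2 ≤ 1 / 4 * Γ.height s₀ x ^ 2 :=
    mul_le_mul_of_nonneg_right (min_le_right _ _) (sq_nonneg _)
  linarith

section Scaling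

variable {Γ} {l : Filter Sph} {s₀ : ℝ}

/-- At parameter distance ητ the chord is η|τ| + O(η²τ²). -/
theorem tendsto_chord_div_height (hl : l ≤ 𝓝 (Γ.toFun s₀)) (hη : ∀ᶠ x in l, 0 < Γ.height s₀ x)
    (τ : ℝ) :
    Tendsto (fun x : Sph => ‖Γ.pos (Γ.foot s₀ x + Γ.height s₀ x * τ) - Γ.pos (Γ.foot s₀ x)‖ /
      Γ.height s₀ x) l (𝓝 |τ|) := by
  have h0 : Tendsto (fun x => Γ.taylorConst * Γ.height s₀ x * τ ^ 2) l (𝓝 0) := by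
    have := (((Γ.tendsto_height s₀).mono_left hl).const_mul Γ.taylorConst).mul_const (τ ^ 2)
    simpa using this
  rw [tendsto_iff_norm_sub_tendsto_zero]
  refine squeeze_zero' (Eventually.of_forall fun x => norm_nonneg _) ?_ h0
  filter_upwards [hη] with x hx
  have h1 := Γ.abs_norm_pos_add_sub_le (Γ.foot s₀ x) (Γ.height s₀ x * τ)
  rw [abs_mul, abs_of_pos hx] at h1
  rw [Real.norm_eq_abs, div_sub' hx.ne', abs_div, abs_of_pos hx, div_le_iff₀ hx]
  exact h1.trans_eq (by ring)

theorem tendsto_inner_normal_div_height (hl : l ≤ 𝓝 (Γ.toFun s₀))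
    (hη : ∀ᶠ x in l, 0 < Γ.height s₀ x) (τ : ℝ) :
    Tendsto (fun x : Sph => (inner ℝ (Γ.pos (Γ.foot s₀ x + Γ.height s₀ x * τ))
      (Γ.normal (Γ.foot s₀ x)) : ℝ) / Γ.height s₀ x) l (𝓝 0) := by
  have h0 : Tendsto (fun x => Γ.taylorConst * Γ.height s₀ x * τ ^ 2) l (𝓝 0) := by
    have := (((Γ.tendsto_height s₀).mono_left hl).const_mul Γ.taylorConst).mul_const (τ ^ 2)
    simpa using this
  refine squeeze_zero_norm' ?_ h0
  filter_upwards [hη] with x hx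
  have h1 := Γ.abs_inner_pos_add_normal_le (Γ.foot s₀ x) (Γ.height s₀ x * τ)
  rw [Real.norm_eq_abs, abs_div, abs_of_pos hx, div_le_iff₀ hx]
  exact h1.trans_eq (by ring)

/-- The rescaled denominator of the kernels. -/
theorem tendsto_one_sub_inner_div_height_sq (hl : l ≤ 𝓝 (Γ.toFun s₀))
    (hη : ∀ᶠ x in l, 0 < Γ.height s₀ x) (τ : ℝ) :
    Tendsto (fun x : Sph => (1 - (inner ℝ (x : E3)
      (Γ.pos (Γ.foot s₀ x + Γ.height s₀ x * τ)) : ℝ)) / Γ.height s₀ x ^ 2) l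
      (𝓝 ((1 + τ ^ 2) / 2)) := by
  have hβ := (Γ.tendsto_inner_pos_foot s₀).mono_left hl
  -- From x = β p(r) + η n(r), the denominator is (1-β) + β·chord²/2 - η⟨p(r+ητ), n(r)⟩, and 1-β =
  -- η²/(1+β). Divided by η², the three terms tend to 1/2, τ²/2 and 0.
  have h1 := (hβ.const_add 1).inv₀ (by norm_num)
  have h2 := hβ.mul (((tendsto_chord_div_height hl hη τ).pow 2).div_const 2)
  have h3 := (h1.add h2).sub (tendsto_inner_normal_div_height hl hη τ)
  have hlim : (1 + 1 : ℝ)⁻¹ + 1 * (|τ| ^ 2 / 2) - 0 = (1 + τ ^ 2) / 2 := by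
    rw [sq_abs]
    ring
  rw [hlim] at h3
  refine h3.congr' ?_
  filter_upwards [hη, hβ.eventually (lt_mem_nhds zero_lt_one)] with x hx hβx
  have e1 := congrArg (fun y : E3 =>
    (inner ℝ y (Γ.pos (Γ.foot s₀ x + Γ.height s₀ x * τ)) : ℝ)) (Γ.eq_foot_frame s₀ x)
  simp only [inner_add_left, real_inner_smul_left] at e1
  have e2 := one_sub_inner_eq (Γ.norm_pos (Γ.foot s₀ x + Γ.height s₀ x * τ))
    (Γ.norm_pos (Γ.foot s₀ x))
  rw [real_inner_comm] at e2
  have e3 := Γ.sq_add_sq_foot s₀ x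
  change _ + Γ.height s₀ x ^ 2 = 1 at e3
  rw [real_inner_comm _ (Γ.normal _)] at e1
  change _ = _ + Γ.height s₀ x * _ at e1
  rw [e1, div_pow, eq_comm, div_eq_iff (by positivity)]
  have hβ1 : 1 + (inner ℝ (x : E3) (Γ.pos (Γ.foot s₀ x)) : ℝ) ≠ 0 := by positivity
  generalize (inner ℝ (x : E3) (Γ.pos (Γ.foot s₀ x)) : ℝ) = β at *
  generalize (inner ℝ (Γ.pos (Γ.foot s₀ x)) (Γ.pos (Γ.foot s₀ x + Γ.height s₀ x * τ)) : ℝ) = p at *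
  generalize (inner ℝ (Γ.pos (Γ.foot s₀ x + Γ.height s₀ x * τ)) (Γ.normal (Γ.foot s₀ x)) : ℝ) = m
    at *
  generalize Γ.height s₀ x = η at *
  have e4 : p = 1 - ‖Γ.pos (Γ.foot s₀ x + η * τ) - Γ.pos (Γ.foot s₀ x)‖ ^ 2 / 2 := by linarith
  rw [e4]
  have e5 : (1 + β)⁻¹ * η ^ 2 = 1 - β := by
    field_simp
    linarith
  field_simp at e5 ⊢
  linear_combination (-2 : ℝ) * e5

variable {μ : Sph → ℝ}

/-- The singular part of the double layer potential tends to the density. -/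
theorem tendsto_singular_part [l.IsCountablyGenerated] (hμ : ContinuousOn μ Γ.trace)
    (hl : l ≤ 𝓝 (Γ.toFun s₀)) (hη : ∀ᶠ x in l, 0 < Γ.height s₀ x) :
    Tendsto (fun x : Sph => Γ.height s₀ x * ∫ h in (-(Γ.length / 2))..(Γ.length / 2),
        μ (Γ.toFun (Γ.foot s₀ x + h)) *
          (inner ℝ (Γ.normal (Γ.foot s₀ x)) (Γ.normal (Γ.foot s₀ x + h)) /
            (1 - inner ℝ (x : E3) (Γ.pos (Γ.foot s₀ x + h))))) l
      (𝓝 (2 * Real.pi * μ (Γ.toFun s₀))) := by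
  obtain ⟨B, hB0, hB⟩ := Γ.exists_density_bound hμ
  obtain ⟨k, hk0, hk⟩ := Γ.exists_sq_add_sq_le_one_sub_inner
  have hL := Γ.length_pos
  have hμc := Γ.continuous_comp_toFun hμ
  set F : Sph → ℝ → ℝ := fun x h => μ (Γ.toFun (Γ.foot s₀ x + h)) *
    (inner ℝ (Γ.normal (Γ.foot s₀ x)) (Γ.normal (Γ.foot s₀ x + h)) /
      (1 - inner ℝ (x : E3) (Γ.pos (Γ.foot s₀ x + h)))) with hF
  set I : Sph → Set ℝ := fun x =>
    Ioc (-(Γ.length / 2) / Γ.height s₀ x) (Γ.length / 2 / Γ.height s₀ x) with hI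
  have hmeas : ∀ x, Measurable (F x) := fun x => by
    have h2 : Continuous fun h => μ (Γ.toFun (Γ.foot s₀ x + h)) := hμc.comp (by fun_prop)
    exact h2.measurable.mul (Γ.measurable_kernel _ _ _)
  -- Substitution h = ητ, with η dh = η² dτ; the indicator records the τ-interval, which grows to
  -- the whole line.
  have hform : ∀ᶠ x in l, (∫ τ, (I x).indicator
      (fun τ => Γ.height s₀ x ^ 2 * F x (Γ.height s₀ x * τ)) τ) =
      Γ.height s₀ x * ∫ h in (-(Γ.length / 2))..(Γ.length / 2), F x h := by
    filter_upwards [hη] with x hx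
    have h1 := intervalIntegral.mul_integral_comp_mul_left
      (a := -(Γ.length / 2) / Γ.height s₀ x) (b := Γ.length / 2 / Γ.height s₀ x)
      (f := F x) (Γ.height s₀ x)
    rw [mul_div_cancel₀ _ hx.ne', mul_div_cancel₀ _ hx.ne'] at h1
    rw [MeasureTheory.integral_indicator measurableSet_Ioc, ← h1,
      ← intervalIntegral.integral_of_le (by gcongr; linarith),
      intervalIntegral.integral_const_mul]
    ring
  refine Tendsto.congr' hform ?_
  have hlim : ∫ τ : ℝ, 2 * μ (Γ.toFun s₀) * (1 + τ ^ 2)⁻¹ = 2 * Real.pi * μ (Γ.toFun s₀) := by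
    rw [MeasureTheory.integral_const_mul, integral_univ_inv_one_add_sq]
    ring
  rw [← hlim]
  -- The denominator is at least kη²(1 + τ²), which cancels the factor η² and leaves an integrable
  -- majorant.
  refine MeasureTheory.tendsto_integral_filter_of_dominated_convergence
    (fun τ => B / k * (1 + τ ^ 2)⁻¹) ?_ ?_ (integrable_inv_one_add_sq.const_mul _) ?_
  · refine Eventually.of_forall fun x => Measurable.aestronglyMeasurable ?_
    exact (((hmeas x).comp (measurable_id.const_mul _)).const_mul _).indicator measurableSet_Ioc
  · filter_upwards [hη] with x hx
    refine Eventually.of_forall fun τ => ?_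
    by_cases hτ : τ ∈ I x
    · rw [indicator_of_mem hτ]
      have hh : |Γ.height s₀ x * τ| ≤ Γ.length / 2 := by
        have h1 := (div_lt_iff₀ hx).1 hτ.1
        have h2 := (le_div_iff₀ hx).1 hτ.2
        exact abs_le.2 ⟨by linarith, by linarith⟩
      have hq := hk s₀ x _ hh
      have hkp : 0 < k * ((Γ.height s₀ x * τ) ^ 2 + Γ.height s₀ x ^ 2) := by positivity
      have hq0 := hkp.trans_le hq
      have hin : |(inner ℝ (Γ.normal (Γ.foot s₀ x))
          (Γ.normal (Γ.foot s₀ x + Γ.height s₀ x * τ)) : ℝ)| ≤ 1 := by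
        have := abs_real_inner_le_norm (Γ.normal (Γ.foot s₀ x))
          (Γ.normal (Γ.foot s₀ x + Γ.height s₀ x * τ))
        rwa [norm_normal, norm_normal, mul_one] at this
      rw [hF, norm_mul, norm_mul, norm_div, Real.norm_of_nonneg (sq_nonneg (Γ.height s₀ x)),
        Real.norm_of_nonneg hq0.le]
      calc _ ≤ Γ.height s₀ x ^ 2 * (B * (1 / (k * ((Γ.height s₀ x * τ) ^ 2 +
            Γ.height s₀ x ^ 2)))) := by
            refine mul_le_mul_of_nonneg_left (mul_le_mul (hB _) ?_ (by positivity) hB0)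
              (sq_nonneg _)
            exact div_le_div₀ zero_le_one hin hkp hq
        _ = B / k * (1 + τ ^ 2)⁻¹ := by
            field_simp
            ring
    · rw [indicator_of_notMem hτ, norm_zero]
      positivity
  · refine Eventually.of_forall fun τ => ?_
    have hη0 := (Γ.tendsto_height s₀).mono_left hl
    have hf := (Γ.tendsto_foot s₀).mono_left hl
    have hfτ : Tendsto (fun x => Γ.foot s₀ x + Γ.height s₀ x * τ) l (𝓝 s₀) := by
      simpa using hf.add (hη0.mul_const τ)
    have h1 := (hμc.tendsto s₀).comp hfτ
    have h2 := ((Γ.continuous_normal.tendsto s₀).comp hf).inner (𝕜 := ℝ)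
      ((Γ.continuous_normal.tendsto s₀).comp hfτ)
    have h3 := h1.mul (h2.div (tendsto_one_sub_inner_div_height_sq hl hη τ) (by positivity))
    have e : μ (Γ.toFun s₀) * (inner ℝ (Γ.normal s₀) (Γ.normal s₀) / ((1 + τ ^ 2) / 2)) =
        2 * μ (Γ.toFun s₀) * (1 + τ ^ 2)⁻¹ := by
      rw [real_inner_self_eq_norm_sq, norm_normal]
      field_simp
    rw [e] at h3
    refine h3.congr' ?_
    have hsmall : ∀ᶠ x in l, Γ.height s₀ x * |τ| < Γ.length / 2 := by
      have : Tendsto (fun x => Γ.height s₀ x * |τ|) l (𝓝 0) := by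
        simpa using hη0.mul_const |τ|
      exact this.eventually (gt_mem_nhds (by positivity))
    filter_upwards [hη, hsmall] with x hx hxs
    have h4 := neg_abs_le τ
    have h5 := le_abs_self τ
    have hτ : τ ∈ I x := by
      constructor
      · rw [div_lt_iff₀ hx]
        nlinarith
      · rw [le_div_iff₀ hx]
        nlinarith
    rw [indicator_of_mem hτ]
    simp only [hF, Function.comp_apply, Pi.div_apply]
    rw [div_div_eq_mul_div]
    ring

end Scaling

/-- The decomposition of the double layer potential at the foot point. -/
theorem doubleLayer_eq_add {μ : Sph → ℝ} (hμ : ContinuousOn μ Γ.trace) (s₀ : ℝ) {x : Sph}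
    (hx : x ∉ Γ.trace) : Γ.doubleLayer μ x =
      inner ℝ (x : E3) (Γ.pos (Γ.foot s₀ x)) * (1 / (4 * Real.pi) *
        ∫ h in (-(Γ.length / 2))..(Γ.length / 2),
          μ (Γ.toFun (Γ.foot s₀ x + h)) * Γ.regularKernel x (Γ.foot s₀ x) h) +
      1 / (4 * Real.pi) * (Γ.height s₀ x * ∫ h in (-(Γ.length / 2))..(Γ.length / 2),
        μ (Γ.toFun (Γ.foot s₀ x + h)) *
          (inner ℝ (Γ.normal (Γ.foot s₀ x)) (Γ.normal (Γ.foot s₀ x + h)) /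
            (1 - inner ℝ (x : E3) (Γ.pos (Γ.foot s₀ x + h))))) := by
  have hμc := Γ.continuous_comp_toFun hμ
  have hint : ∀ v : E3, IntervalIntegrable (fun h => μ (Γ.toFun (Γ.foot s₀ x + h)) *
      (inner ℝ v (Γ.normal (Γ.foot s₀ x + h)) /
        (1 - inner ℝ (x : E3) (Γ.pos (Γ.foot s₀ x + h))))) MeasureTheory.volume
      (-(Γ.length / 2)) (Γ.length / 2) := fun v => by
    have h0 : Continuous fun h => μ (Γ.toFun (Γ.foot s₀ x + h)) := hμc.comp (by fun_prop)
    have h1 : Continuous fun h => (inner ℝ v (Γ.normal (Γ.foot s₀ x + h)) : ℝ) :=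
      continuous_const.inner (Γ.continuous_normal.comp (by fun_prop))
    have h2 : Continuous fun h => 1 - (inner ℝ (x : E3) (Γ.pos (Γ.foot s₀ x + h)) : ℝ) :=
      continuous_const.sub (continuous_const.inner (Γ.continuous_pos.comp (by fun_prop)))
    exact (h0.mul (h1.div h2 fun h => sub_ne_zero.2
      (inner_sph_ne_one (Γ.ne_of_notMem_trace hx _).symm).symm)).intervalIntegrable _ _
  have hper : Γ.doubleLayer μ x = ∫ h in (-(Γ.length / 2))..(Γ.length / 2),
      μ (Γ.toFun (Γ.foot s₀ x + h)) * (1 / (4 * Real.pi) *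
        (inner ℝ (x : E3) (Γ.normal (Γ.foot s₀ x + h)) /
          (1 - inner ℝ (x : E3) (Γ.pos (Γ.foot s₀ x + h))))) := by
    rw [doubleLayer, ← Γ.integral_eq_shift (f := fun s => μ (Γ.toFun s) * (1 / (4 * Real.pi) *
      (inner ℝ (x : E3) (Γ.normal s) / (1 - inner ℝ (x : E3) (Γ.pos s)))))
      (fun s => by simp only [Γ.periodic s, Γ.periodic_normal s, Γ.periodic_pos s])]
    exact intervalIntegral.integral_congr fun s _ => by
      simp only [Γ.doubleKernel_eq (Γ.ne_of_notMem_trace hx s)]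
  simp only [regularKernel]
  rw [hper, ← mul_assoc, ← mul_assoc (1 / (4 * Real.pi)) (Γ.height s₀ x)]
  rw [← intervalIntegral.integral_const_mul, ← intervalIntegral.integral_const_mul,
    ← intervalIntegral.integral_add ((hint _).const_mul _) ((hint _).const_mul _)]
  refine intervalIntegral.integral_congr fun h _ => ?_
  -- Only the numerator is expanded in the frame at the foot: its p(r)-part gives the regular
  -- kernel, its n(r)-part the singular one.
  have e1 := congrArg (fun y : E3 => (inner ℝ y (Γ.normal (Γ.foot s₀ x + h)) : ℝ))
    (Γ.eq_foot_frame s₀ x)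
  simp only [inner_add_left, real_inner_smul_left] at e1
  change _ = _ + Γ.height s₀ x * _ at e1
  rw [e1]
  ring

variable {Γ} {S₁ S₂ : Set Sph}

/-- The jump relation of the double layer potential. -/
theorem Divides.tendsto_doubleLayer (hΓ : Γ.Divides S₁ S₂) {μ : Sph → ℝ}
    (hμ : ContinuousOn μ Γ.trace) (s₀ : ℝ) : Tendsto (Γ.doubleLayer μ) (𝓝[S₂] (Γ.toFun s₀))
      (𝓝 (1 / 2 * μ (Γ.toFun s₀) + Γ.opK μ (Γ.toFun s₀))) := by
  have hη : ∀ᶠ x in 𝓝[S₂] (Γ.toFun s₀), 0 < Γ.height s₀ x :=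
    hΓ.eventually_inner_normal_foot_pos s₀
  have h1 := (tendsto_singular_part hμ nhdsWithin_le_nhds hη).const_mul (1 / (4 * Real.pi))
  have h2 := ((Γ.tendsto_inner_pos_foot s₀).mul ((Γ.tendsto_regular_part hμ s₀).const_mul
    (1 / (4 * Real.pi)))).mono_left (nhdsWithin_le_nhds (s := S₂))
  have h3 := h2.add h1
  have hlim : 1 * (1 / (4 * Real.pi) * ∫ h in (-(Γ.length / 2))..(Γ.length / 2),
      μ (Γ.toFun (s₀ + h)) * Γ.regularKernel (Γ.pos s₀) s₀ h) +
      1 / (4 * Real.pi) * (2 * Real.pi * μ (Γ.toFun s₀)) =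
      1 / 2 * μ (Γ.toFun s₀) + Γ.opK μ (Γ.toFun s₀) := by
    rw [← Γ.opK_eq hμ]
    have := Real.pi_pos
    field_simp
    ring
  rw [hlim] at h3
  refine h3.congr' ?_
  filter_upwards [self_mem_nhdsWithin] with x hx
  exact (Γ.doubleLayer_eq_add hμ s₀ (hΓ.notMem_trace_of_mem_two hx)).symm

end SphCurve

/-! ### The theorem -/

theorem mainTheorem4 (Γ : SphCurve) (S₁ S₂ : Set Sph) (hΓ : Γ.Divides S₁ S₂) (g : Sph → ℝ) :
    (∀ σ : Sph → ℝ, ContinuousOn σ Γ.trace →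
      (∀ x ∈ Γ.trace, Γ.opV σ x = g x) → Γ.lineIntegral σ = 0 →
        Γ.SolvesDirichlet S₂ g (Γ.singleLayer σ)) ∧
    (∀ μ : Sph → ℝ, ContinuousOn μ Γ.trace →
      (∀ x ∈ Γ.trace, (1 / 2 : ℝ) * μ x + Γ.opK μ x = g x) →
        Γ.SolvesDirichlet S₂ g (Γ.doubleLayer μ) ∧
        ∀ v : Sph → ℝ, Γ.SolvesDirichlet S₂ g v → EqOn v (Γ.doubleLayer μ) S₂) := by
  have hsub : S₂ ⊆ Γ.traceᶜ := fun x hx => hΓ.notMem_trace_of_mem_two hx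
  refine ⟨fun σ hσ hV hint => ⟨(Γ.contMDiffOn_singleLayer hσ).mono hsub, fun x hx => ?_, ?_⟩,
    fun μ hμ hK => ?_⟩
  · rw [Γ.laplaceBeltrami_singleLayer hσ (hsub hx), hint, mul_zero]
  · rintro _ ⟨s₀, rfl⟩
    -- On the curve `opV` is the same integral as `singleLayer`, so continuity there is enough.
    rw [← hV _ (mem_range_self s₀)]
    exact (Γ.continuousAt_singleLayer hσ s₀).tendsto.mono_left nhdsWithin_le_nhds
  · have hW : Γ.SolvesDirichlet S₂ g (Γ.doubleLayer μ) := by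
      refine ⟨(Γ.contMDiffOn_doubleLayer hμ).mono hsub,
        fun x hx => Γ.laplaceBeltrami_doubleLayer hμ (hsub hx), ?_⟩
      rintro _ ⟨s₀, rfl⟩
      rw [← hK _ (mem_range_self s₀)]
      exact hΓ.tendsto_doubleLayer hμ s₀
    exact ⟨hW, fun v hv => hΓ.solvesDirichlet_unique hv hW⟩
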